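/- For $j\ge 1$ let $\Lambda_j=[-j,j]^4\cap\mathbb Z^4$. Let $\Omega^k$ be the space of real $k$-forms on $\Lambda_j$ (functions on oriented $k$-cells, odd under reversal of orientation), with $\langle f,g\rangle=\sum_w f(w)g(w)$ over unoriented $k$-cells $w$, and let $\mathring\Omega^k\subset\Omega^k$ be the subspace of forms vanishing on the $k$-cells contained in the boundary of $[-j,j]^4$. On $\Omega^k$ (free boundary condition) or on $\mathring\Omega^k$ (zero boundary condition) let $\mathrm d$ be the discrete exterior derivative, $\mathrm df(w)=\sum_{v\in\partial w}f(v)$, let $\mathrm d^*=-\mathrm d^{t}$, with the transpose taken in the respective spaces, and let $\Delta=\mathrm d\mathrm d^*+\mathrm d^*\mathrm d$, which is negative definite on $3$-forms. The Coulomb gas partition function with the given boundary condition is $$Z^{Coul}_{\beta,\Lambda_j}=\sum_{q}\exp\Big(-\frac{\beta(2\pi)^2}{2}\langle q,(-\Delta)^{-1}q\rangle\Big),$$ where $q$ runs over the integer-valued $3$-forms (in $\mathring\Omega^3$ for the zero boundary condition) with $\mathrm dq=0$. Put $f_j^{Coul}(\beta)=\frac{1}{4(2j)^4}\ln Z^{Coul}_{\beta,\Lambda_j}$.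 Proposition. For every $\delta>0$ there exist $\beta_0>0$ and $C>0$, depending only on $\delta$, such that for both boundary conditions, all $\beta\ge\beta_0$ and all integers $j\ge1$: the series defining $Z^{Coul}_{\beta,\Lambda_j}$ converges, $$f_j^{Coul}(\beta)\ \ge\ \frac38\int_\beta^\infty e^{-\pi^2\tilde\beta(1+\delta)}\,d\tilde\beta-\frac Cj ,$$ and $f_j^{Coul}$ is differentiable at $\beta$ with $$\frac{d}{d\beta}f_j^{Coul}(\beta)\ \le\ -\frac38\,e^{-\beta\pi^2(1+\delta)}\Big(1-\frac Cj\Big).$$ -/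

import Mathlib

namespace CubeForms

/-- An unoriented (equivalently, positively oriented) cell of `ℤⁿ`: the pair `(x, S)` stands for the
cell based at `x` and spanned by the basis vectors `e_i`, `i ∈ S`, in increasing order of `i`. As a
subset of `ℝⁿ` it is the product of `[x i, x i + 1]` over `i ∈ S` and of `{x i}` over `i ∉ S`. -/
abbrev LatticeCell (n : ℕ) : Type := (Fin n → ℤ) × Finset (Fin n)

/-- The cell is contained in the topological boundary of the cube `[-j, j]ⁿ` (for cells of the
cube): some coordinate is constant on the cell, equal to `j` or `-j`. -/
abbrev IsBoundaryCell {n : ℕ} (j : ℕ) (w : LatticeCell n) : Prop :=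
  ∃ i, i ∉ w.2 ∧ |w.1 i| = (j : ℤ)

/-- The `k`-cells of `Λ_j = [-j, j]ⁿ ∩ ℤⁿ`. -/
noncomputable def cubeCells (n j k : ℕ) : Finset (LatticeCell n) :=
  ((Fintype.piFinset fun _ => Finset.Icc (-(j : ℤ)) (j : ℤ)) ×ˢ
    (Finset.univ : Finset (Fin n)).powersetCard k).filter
      (fun w => ∀ i ∈ w.2, w.1 i + 1 ≤ (j : ℤ))

/-- Free or zero boundary condition. -/
inductive BoundaryCondition : Type
  | free
  | zero

/-- The `k`-cells of `Λ_j` on which `k`-forms are unconstrained: all of them for the free boundary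
condition, those not contained in the boundary of the cube for the zero boundary condition. -/
noncomputable def cells (b : BoundaryCondition) (n j k : ℕ) : Finset (LatticeCell n) :=
  match b with
  | .free => cubeCells n j k
  | .zero => (cubeCells n j k).filter (fun w => ¬ IsBoundaryCell j w)

/-- `k`-forms with values in `R`. A form is odd under reversal of orientation, so it is given by its
values on the positively oriented cells; with zero boundary condition it vanishes on the boundary
cells, so it is given by its values on the other ones. -/
abbrev Form (R : Type*) (b : BoundaryCondition) (n j k : ℕ) : Type _ := cells b n j k → R

/-- The face of the cell `w` orthogonal to `e_i` (`i ∈ w.2`) and based at `x + ε e_i`. -/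
def face {n : ℕ} (w : LatticeCell n) (i : Fin n) (ε : ℕ) : LatticeCell n :=
  (Function.update w.1 i (w.1 i + (ε : ℤ)), w.2.erase i)

/-- The coefficient of `v` in
`∂w = ∑_{ε ∈ {0,1}} ∑_m (-1)^(ε+m) (v_1 ∧ ⋯ ∧ (omit v_m) ∧ ⋯ ∧ v_k)_{x + ε v_m}`;
`m` is the rank (counted from one) of the omitted direction among the directions of `w`. -/
def incidence {n : ℕ} (w v : LatticeCell n) : ℤ :=
  ∑ ε ∈ Finset.range 2, ∑ i ∈ w.2,
    if v = face w i ε then (-1) ^ (ε + (w.2.filter (fun l => l ≤ i)).card) else 0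

/-- The matrix of the exterior derivative `d` from `k`-forms to `(k+1)`-forms,
`(d f)(w) = ∑_{v ∈ ∂w} f(v)`. (All faces of a boundary cell are boundary cells, so with zero
boundary condition this is the restriction of `d` to the forms vanishing on the boundary.) -/
noncomputable def d (R : Type*) [Ring R] (b : BoundaryCondition) (n j k : ℕ) :
    Matrix (cells b n j (k + 1)) (cells b n j k) R :=
  Matrix.of fun w v => ((incidence (w : LatticeCell n) (v : LatticeCell n) : ℤ) : R)

/-- `d* = -dᵗ`, from `(k+1)`-forms to `k`-forms; the transpose is taken in the space of forms with
the given boundary condition. -/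
noncomputable def dStar (R : Type*) [Ring R] (b : BoundaryCondition) (n j k : ℕ) :
    Matrix (cells b n j k) (cells b n j (k + 1)) R :=
  -(d R b n j k).transpose

/-- The Laplacian `Δ = d d* + d* d` on real `(k+1)`-forms. -/
noncomputable def laplacian (b : BoundaryCondition) (n j k : ℕ) :
    Matrix (cells b n j (k + 1)) (cells b n j (k + 1)) ℝ :=
  d ℝ b n j k * dStar ℝ b n j k + dStar ℝ b n j (k + 1) * d ℝ b n j (k + 1)

/-- `⟨q, (-Δ)⁻¹ q⟩` for an integer-valued `3`-form `q` on the four-dimensional cube, where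
`⟨f, g⟩ = ∑_w f(w) g(w)` over unoriented cells. -/
noncomputable def coulombEnergy (b : BoundaryCondition) (j : ℕ) (q : Form ℤ b 4 j 3) : ℝ :=
  dotProduct (fun w => (q w : ℝ)) ((-(laplacian b 4 j 2))⁻¹.mulVec (fun w => (q w : ℝ)))

/-- The configurations of the Coulomb gas: closed integer-valued `3`-forms. -/
def CoulombConfig (b : BoundaryCondition) (j : ℕ) : Type :=
  {q : Form ℤ b 4 j 3 // (d ℤ b 4 j 3).mulVec q = 0}

/-- The Boltzmann weight `exp (-(β (2π)² / 2) ⟨q, (-Δ)⁻¹ q⟩)`. -/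
noncomputable def coulombWeight (b : BoundaryCondition) (j : ℕ) (β : ℝ) (q : CoulombConfig b j) :
    ℝ :=
  Real.exp (-(β * (2 * Real.pi) ^ 2 / 2) * coulombEnergy b j q.1)

/-- The partition function of the Coulomb gas. -/
noncomputable def coulombZ (b : BoundaryCondition) (j : ℕ) (β : ℝ) : ℝ :=
  ∑' q : CoulombConfig b j, coulombWeight b j β q

/-- The free energy `f_j(β) = ln Z / (4 (2j)⁴)`. -/
noncomputable def coulombFreeEnergy (b : BoundaryCondition) (j : ℕ) (β : ℝ) : ℝ :=
  1 / (4 * (2 * (j : ℝ)) ^ 4) * Real.log (coulombZ b j β)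

end CubeForms

/-! For a closed charge `q` the Coulomb energy is the squared norm of the field `φ(q) = dᵗ(-Δ)⁻¹q`,
so it splits into contributions `φ_p(q)²` of the plaquettes `p`. Adding the charge `d 1_p` permutes
the configurations; it changes the energy by `2φ_p + e_p` and `φ_p` by `e_p`, where `e_p` is the
diagonal entry at `p` of the orthogonal projection `dᵗ(-Δ)⁻¹d`. Since one of `q`, `q + d 1_p`, `q -
d 1_p` always has `|φ_p| ≥ e_p / 2` at an energy cost of at most `e_p`, the Gibbs mean of `φ_p²` is
at least `e_p² exp(-a e_p) / 12`, with `a = 2π²β` (`exp_mul_tsum_le_tsum_sq`,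
`sum_plaquetteEnergy_mul_le`).

The sum of the `e_p` is the trace of a projection, hence the rank of `d` on 2-forms. Up to surface
terms this is at most `4L⁴ - L⁴ = 3L⁴` with `L = 2j` (`sum_plaquetteEnergy_le`), while there are
about `6L⁴` plaquettes. The mean of `e_p` is thus at most about `1/2`, and by Markov's inequality a
positive fraction of plaquettes has `e_p ≤ (1 + δ)/2` (`card_plaquetteEnergy_le`). As `e_p ≥
1/1024`, the derivative of the free energy is at most a negative constant times `exp(-π²β(1 + δ))`.
Running this with `δ/2` leaves a factor `exp(π²βδ/2)`, which for large `β` raises the poor constant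
to `3/8`. Integrating from `β` to infinity and using that the free energy is nonnegative gives the
other bound. Small `j` are covered by taking `C` large.

The algebra rests on the absence of harmonic 3-forms (`eq_zero_of_closed_of_coclosed`), which makes
`-Δ` invertible. -/

namespace CubeForms

/-! ### Signs and incidences of cells, one direction at a time. -/

section Combinatorics

variable {n : ℕ}

/-- The admissible positions of one coordinate of a cell, `e` telling whether the cell extends in
that direction. -/
noncomputable def coordSet (b : BoundaryCondition) (j : ℕ) (e : Prop) [Decidable e] : Finset ℤ :=
  if e then Finset.Ico (-(j : ℤ)) j else
    match b with
    | .free => Finset.Icc (-(j : ℤ)) j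
    | .zero => Finset.Ioo (-(j : ℤ)) j

/-- Both boundary conditions are product conditions on the coordinates. This lets a cell be moved in
one coordinate without checking the others, and reduces counting to products. -/
theorem mem_cells_iff {b : BoundaryCondition} {j k : ℕ} {w : LatticeCell n} :
    w ∈ cells b n j k ↔ (∀ i, w.1 i ∈ coordSet b j (i ∈ w.2)) ∧ w.2.card = k := by
  cases b
  · simp only [cells, cubeCells, Finset.mem_filter, Finset.mem_product, Fintype.mem_piFinset,
      Finset.mem_Icc, Finset.mem_powersetCard, Finset.subset_univ, true_and, coordSet]
    constructor
    · rintro ⟨⟨h1, h2⟩, h3⟩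
      refine ⟨fun i => ?_, h2⟩
      have := h1 i
      have := h3 i
      split_ifs with h
      · rw [Finset.mem_Ico]; have := this h; omega
      · rw [Finset.mem_Icc]; omega
    · rintro ⟨h1, h2⟩
      refine ⟨⟨fun i => ?_, h2⟩, fun i hi => ?_⟩
      · have := h1 i
        split_ifs at this with h
        · rw [Finset.mem_Ico] at this; omega
        · rw [Finset.mem_Icc] at this; omega
      · have := h1 i
        rw [if_pos hi, Finset.mem_Ico] at this; omega
  · simp only [cells, cubeCells, Finset.mem_filter, Finset.mem_product, Fintype.mem_piFinset,
      Finset.mem_Icc, Finset.mem_powersetCard, Finset.subset_univ, true_and, coordSet,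
      IsBoundaryCell, not_exists, not_and]
    constructor
    · rintro ⟨⟨⟨h1, h2⟩, h3⟩, h4⟩
      refine ⟨fun i => ?_, h2⟩
      have := h1 i
      have := h3 i
      have h4 := h4 i
      split_ifs with h
      · rw [Finset.mem_Ico]; have := this h; omega
      · have h4 := h4 h
        rw [Finset.mem_Ioo]
        grind
    · rintro ⟨h1, h2⟩
      refine ⟨⟨⟨fun i => ?_, h2⟩, fun i hi => ?_⟩, fun i hi => ?_⟩
      · have := h1 i
        split_ifs at this with h
        · rw [Finset.mem_Ico] at this; omega
        · rw [Finset.mem_Ioo] at this; omega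
      · have := h1 i
        rw [if_pos hi, Finset.mem_Ico] at this; omega
      · have := h1 i
        rw [if_neg hi, Finset.mem_Ioo] at this
        grind

/-- The cells of all dimensions on which forms are unconstrained. -/
noncomputable def allCells (b : BoundaryCondition) (n j : ℕ) : Finset (LatticeCell n) :=
  (Finset.range (n + 1)).biUnion (cells b n j)

theorem mem_allCells_iff {b : BoundaryCondition} {j : ℕ} {w : LatticeCell n} :
    w ∈ allCells b n j ↔ ∀ i, w.1 i ∈ coordSet b j (i ∈ w.2) := by
  simp only [allCells, Finset.mem_biUnion, Finset.mem_range, mem_cells_iff]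
  constructor
  · rintro ⟨k, -, h, -⟩; exact h
  · intro h
    exact ⟨_, Nat.lt_succ_of_le (by simpa using Finset.card_le_univ w.2), h, rfl⟩

theorem mem_cells_iff_mem_allCells {b : BoundaryCondition} {j k : ℕ} {w : LatticeCell n} :
    w ∈ cells b n j k ↔ w ∈ allCells b n j ∧ w.2.card = k := by
  rw [mem_cells_iff, mem_allCells_iff]

/-- The cell extending in direction `i` whose face orthogonal to `e_i` at `ε` is `v`. -/
def coface (v : LatticeCell n) (i : Fin n) (ε : ℕ) : LatticeCell n :=
  (Function.update v.1 i (v.1 i - (ε : ℤ)), insert i v.2)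

theorem eq_face_iff {w v : LatticeCell n} {i : Fin n} {ε : ℕ} :
    (i ∈ w.2 ∧ v = face w i ε) ↔ (i ∉ v.2 ∧ w = coface v i ε) := by
  constructor
  · rintro ⟨h, rfl⟩
    refine ⟨by simp [face], ?_⟩
    ext1
    · simp [face, coface]
    · simp [face, coface, h]
  · rintro ⟨h, rfl⟩
    refine ⟨by simp [coface], ?_⟩
    ext1
    · simp [face, coface]
    · simp [face, coface, h]

/-- The orientation sign of the direction `i` among the directions of `S`. -/
def orientSign (S : Finset (Fin n)) (i : Fin n) : ℤ :=
  (-1) ^ (S.filter (fun l => l ≤ i)).card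

theorem orientSign_mul_self (S : Finset (Fin n)) (i : Fin n) :
    orientSign S i * orientSign S i = 1 := by
  rw [orientSign, ← mul_pow]; simp

theorem orientSign_ne_zero (S : Finset (Fin n)) (i : Fin n) : orientSign S i ≠ 0 := by
  simp [orientSign]

theorem orientSign_erase {S : Finset (Fin n)} {l : Fin n} (hl : l ∈ S) (i : Fin n) :
    orientSign (S.erase l) i = if l ≤ i then -orientSign S i else orientSign S i := by
  unfold orientSign
  rw [Finset.filter_erase]
  split_ifs with h
  · have hm : l ∈ S.filter (fun m => m ≤ i) := by simp [hl, h]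
    rw [← Finset.card_erase_add_one hm, pow_succ]; ring
  · rw [Finset.erase_eq_of_notMem]; simp [h]

/-- Of two distinct directions exactly one precedes the other, so removing each one flips exactly
one of the two signs. -/
theorem orientSign_erase_mul {S : Finset (Fin n)} {i l : Fin n} (hil : i ≠ l) (hi : i ∈ S)
    (hl : l ∈ S) :
    orientSign (S.erase l) i * orientSign (S.erase i) l = -(orientSign S i * orientSign S l) := by
  rw [orientSign_erase hl, orientSign_erase hi]
  rcases lt_or_gt_of_ne hil with h | h
  · simp [h.le, h.not_ge]
  · simp [h.le, h.not_ge]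

theorem orientSign_mul_erase {S : Finset (Fin n)} {i l : Fin n} (hil : i ≠ l) (hi : i ∈ S)
    (hl : l ∈ S) :
    orientSign S i * orientSign (S.erase i) l = -(orientSign S l * orientSign (S.erase l) i) := by
  rw [orientSign_erase hl, orientSign_erase hi]
  rcases lt_or_gt_of_ne hil with h | h
  · simp [h.le, h.not_ge]; ring
  · simp [h.le, h.not_ge]; ring

/-- The part of `incidence w v` coming from the faces orthogonal to `e_i`. -/
def dirIncidence (i : Fin n) (w v : LatticeCell n) : ℤ :=
  ∑ ε ∈ Finset.range 2,
    if i ∈ w.2 ∧ v = face w i ε then (-1) ^ ε * orientSign w.2 i else 0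

theorem sum_dirIncidence (w v : LatticeCell n) :
    ∑ i, dirIncidence i w v = incidence w v := by
  unfold incidence dirIncidence
  rw [Finset.sum_comm]
  refine Finset.sum_congr rfl fun ε _ => ?_
  simp only [ite_and]
  rw [Finset.sum_ite_mem, Finset.univ_inter]
  simp only [orientSign, pow_add]

theorem dirIncidence_eq_coface (i : Fin n) (w v : LatticeCell n) :
    dirIncidence i w v = ∑ ε ∈ Finset.range 2,
      if i ∉ v.2 ∧ w = coface v i ε then (-1) ^ ε * orientSign (insert i v.2) i else 0 := by
  refine Finset.sum_congr rfl fun ε _ => ?_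
  simp only [eq_face_iff]
  split_ifs with h
  · rw [h.2]; rfl
  · rfl

theorem dirIncidence_face {i : Fin n} {w : LatticeCell n} (hi : i ∈ w.2) {ε : ℕ} (hε : ε < 2) :
    dirIncidence i w (face w i ε) = (-1) ^ ε * orientSign w.2 i := by
  unfold dirIncidence
  rw [Finset.sum_eq_single_of_mem ε (by simpa using hε)]
  · simp [hi]
  · intro ε' _ hne
    rw [if_neg]
    rintro ⟨-, h⟩
    have := congrFun (congrArg Prod.fst h) i
    simp only [face, Function.update_self] at this
    omega

theorem card_of_dirIncidence_ne_zero {i : Fin n} {w v : LatticeCell n}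
    (h : dirIncidence i w v ≠ 0) : v.2 = w.2.erase i ∧ i ∈ w.2 := by
  obtain ⟨ε, -, h⟩ := Finset.exists_ne_zero_of_sum_ne_zero h
  have h : i ∈ w.2 ∧ v = face w i ε := by by_contra h'; simp [h'] at h
  exact ⟨by rw [h.2]; rfl, h.1⟩

theorem dirIncidence_eq_zero_of_card {i : Fin n} {w v : LatticeCell n}
    (h : w.2.card ≠ v.2.card + 1) : dirIncidence i w v = 0 := by
  by_contra h'
  obtain ⟨h1, h2⟩ := card_of_dirIncidence_ne_zero h'
  rw [h1, Finset.card_erase_add_one h2] at h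
  exact h rfl

theorem sum_dirIncidence_mul (s : Finset (LatticeCell n)) (i : Fin n) (w : LatticeCell n)
    {R : Type*} [CommRing R] (F : LatticeCell n → R) :
    ∑ v ∈ s, (dirIncidence i w v : R) * F v = ∑ ε ∈ Finset.range 2,
      if i ∈ w.2 ∧ face w i ε ∈ s then
        (((-1) ^ ε * orientSign w.2 i : ℤ) : R) * F (face w i ε) else 0 := by
  unfold dirIncidence
  simp only [Int.cast_sum, Finset.sum_mul]
  rw [Finset.sum_comm]
  refine Finset.sum_congr rfl fun ε _ => ?_
  by_cases hi : i ∈ w.2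
  · simp only [hi, true_and, Int.cast_ite, Int.cast_zero, ite_mul, zero_mul]
    rw [Finset.sum_ite_eq']
  · simp [hi]

theorem sum_dirIncidence_mul' (s : Finset (LatticeCell n)) (i : Fin n) (v : LatticeCell n)
    {R : Type*} [CommRing R] (F : LatticeCell n → R) :
    ∑ w ∈ s, (dirIncidence i w v : R) * F w = ∑ ε ∈ Finset.range 2,
      if i ∉ v.2 ∧ coface v i ε ∈ s then
        (((-1) ^ ε * orientSign (insert i v.2) i : ℤ) : R) * F (coface v i ε) else 0 := by
  simp only [dirIncidence_eq_coface, Int.cast_sum, Finset.sum_mul]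
  rw [Finset.sum_comm]
  refine Finset.sum_congr rfl fun ε _ => ?_
  by_cases hi : i ∉ v.2
  · simp only [hi, not_false_eq_true, true_and, Int.cast_ite, Int.cast_zero, ite_mul, zero_mul]
    rw [Finset.sum_ite_eq']
  · simp [hi]

theorem face_comm (w : LatticeCell n) {i l : Fin n} (hil : i ≠ l) (ε ε' : ℕ) :
    face (face w i ε) l ε' = face (face w l ε') i ε := by
  ext1
  · simp only [face, Function.update_of_ne hil, Function.update_of_ne hil.symm]
    rw [Function.update_comm hil]
  · simp only [face]
    rw [Finset.erase_right_comm]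

/-- The intermediate cell agrees with `w` in coordinate `l` and with the double face in all the
others, and admissibility is coordinatewise. -/
theorem face_mem_of_face_face_mem {b : BoundaryCondition} {j : ℕ} {w : LatticeCell n}
    {i l : Fin n} (hil : i ≠ l) {ε ε' : ℕ} (hw : w ∈ allCells b n j)
    (hu : face (face w i ε) l ε' ∈ allCells b n j) : face w i ε ∈ allCells b n j := by
  rw [mem_allCells_iff] at *
  intro m
  by_cases hm : m = l
  · subst hm
    simpa [face, hil.symm] using hw m
  · simpa [face, hm] using hu m

/-- The directional derivatives anticommute: taking faces in the two orders reaches the same cell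
with opposite signs. For `i = l` both sums vanish, a direction being removable only once. -/
theorem sum_dirIncidence_comp (b : BoundaryCondition) (j : ℕ) (i l : Fin n) {w u : LatticeCell n}
    (hw : w ∈ allCells b n j) (hu : u ∈ allCells b n j) :
    ∑ v ∈ allCells b n j, dirIncidence i w v * dirIncidence l v u
      + ∑ v ∈ allCells b n j, dirIncidence l w v * dirIncidence i v u = 0 := by
  have h1 := fun i l => sum_dirIncidence_mul (allCells b n j) i w (R := ℤ)
    (fun v => dirIncidence l v u)
  simp only [Int.cast_id] at h1
  rw [h1, h1]
  by_cases hil : i = l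
  · subst hil
    simp [dirIncidence, face]
  unfold dirIncidence
  rw [← eq_neg_iff_add_eq_zero, ← Finset.sum_neg_distrib]
  simp only [Finset.mul_sum]
  have e : ∀ (p : Prop) [Decidable p] (f : ℕ → ℤ),
      (if p then ∑ x ∈ Finset.range 2, f x else 0)
        = ∑ x ∈ Finset.range 2, if p then f x else 0 := by
    intro p _ f; split_ifs <;> simp
  simp only [e, ← Finset.sum_neg_distrib]
  conv_rhs => rw [Finset.sum_comm]
  refine Finset.sum_congr rfl fun ε _ => Finset.sum_congr rfl fun ε' _ => ?_
  simp only [mul_ite, mul_zero, ← ite_and]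
  by_cases h : (i ∈ w.2 ∧ face w i ε ∈ allCells b n j) ∧
      l ∈ (face w i ε).2 ∧ u = face (face w i ε) l ε'
  · obtain ⟨⟨ha, hb⟩, hc, hd⟩ := h
    have hc' : l ∈ w.2 := by simp [face] at hc; exact hc.2
    have hd' := hd
    rw [face_comm _ hil] at hd'
    rw [if_pos ⟨⟨ha, hb⟩, hc, hd⟩, if_pos]
    · have := orientSign_mul_erase hil ha hc'
      simp only [face]
      linear_combination (-1) ^ ε * (-1) ^ ε' * this
    · refine ⟨⟨hc', ?_⟩, by simp [face, hil, ha], hd'⟩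
      exact face_mem_of_face_face_mem (Ne.symm hil) hw (hd' ▸ hu)
  · rw [if_neg h, if_neg, neg_zero]
    rintro ⟨⟨ha, hb⟩, hc, hd⟩
    have hc' : i ∈ w.2 := by simp [face] at hc; exact hc.2
    have hd' := hd
    rw [face_comm _ (Ne.symm hil)] at hd'
    exact h ⟨⟨hc', face_mem_of_face_face_mem hil hw (hd' ▸ hu)⟩,
      by simp [face, Ne.symm hil, ha], hd'⟩

/-- Two routes from `w` to `u`: down in `i` then up in `l`, or up in `l` then down in `i`. The
product structure of the domain makes one intermediate cell admissible exactly when the other is. -/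
theorem face_eq_face_iff {b : BoundaryCondition} {j : ℕ} {i l : Fin n} (hil : i ≠ l)
    {w u : LatticeCell n} (hw : w ∈ allCells b n j) (hu : u ∈ allCells b n j) {ε ε' : ℕ} :
    ((i ∈ w.2 ∧ face w i ε ∈ allCells b n j) ∧ l ∈ u.2 ∧ face w i ε = face u l ε') ↔
      ((l ∉ w.2 ∧ coface w l ε' ∈ allCells b n j) ∧ i ∉ u.2 ∧ coface w l ε' = coface u i ε) := by
  have hli := Ne.symm hil
  rw [mem_allCells_iff] at hw hu ⊢
  rw [mem_allCells_iff]
  constructor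
  · rintro ⟨⟨h1, h2⟩, h3, h4⟩
    have hx : ∀ m, (face w i ε).1 m = (face u l ε').1 m := fun m => by rw [h4]
    have hS : ∀ m, m ∈ (face w i ε).2 ↔ m ∈ (face u l ε').2 := fun m => by rw [h4]
    simp only [face, Finset.mem_erase] at hx hS
    have hlw : l ∉ w.2 := fun h => by simpa [h, hli] using hS l
    have hiu : i ∉ u.2 := fun h => by simpa [h, hil] using hS i
    have heq : coface w l ε' = coface u i ε := by
      ext m
      · have := hx m
        by_cases hmi : m = i
        · subst hmi
          simp [hil] at this
          simp [coface, hil, ← this]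
        · by_cases hml : m = l
          · subst hml
            simp [hli] at this
            simp [coface, hli, this]
          · simpa [coface, hmi, hml] using this
      · have := hS m
        by_cases hmi : m = i
        · subst hmi; simp [coface, h1]
        · by_cases hml : m = l
          · subst hml; simp [coface, h3]
          · simpa [coface, hmi, hml] using this
    refine ⟨⟨hlw, fun m => ?_⟩, hiu, heq⟩
    by_cases hml : m = l
    · subst hml
      rw [heq]
      simpa [coface, hli] using hu m
    · simpa [coface, hml] using hw m
  · rintro ⟨⟨h1, h2⟩, h3, h4⟩
    have hx : ∀ m, (coface w l ε').1 m = (coface u i ε).1 m := fun m => by rw [h4]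
    have hS : ∀ m, m ∈ (coface w l ε').2 ↔ m ∈ (coface u i ε).2 := fun m => by rw [h4]
    simp only [coface, Finset.mem_insert] at hx hS
    have hiw : i ∈ w.2 := by simpa [hil] using hS i
    have hlu : l ∈ u.2 := by simpa [hli] using hS l
    have heq : face w i ε = face u l ε' := by
      ext m
      · have := hx m
        by_cases hmi : m = i
        · subst hmi
          simp [hil] at this
          simp [face, hil, this]
        · by_cases hml : m = l
          · subst hml
            simp [hli] at this
            simp [face, hli, ← this]
          · simpa [face, hmi, hml] using this
      · have := hS m
        by_cases hmi : m = i
        · subst hmi; simp [face, h3]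
        · by_cases hml : m = l
          · subst hml; simp [face, h1]
          · simpa [face, hmi, hml] using this
    refine ⟨⟨hiw, fun m => ?_⟩, hlu, heq⟩
    by_cases hmi : m = i
    · subst hmi
      rw [heq]
      simpa [face, hil] using hu m
    · simpa [face, hmi] using hw m

/-- Matching the two routes of `face_eq_face_iff`, whose signs are opposite, shows that the cross
terms of the Laplacian between different directions cancel. -/
theorem sum_dirIncidence_mixed (b : BoundaryCondition) (j : ℕ) {i l : Fin n} (hil : i ≠ l)
    {w u : LatticeCell n} (hw : w ∈ allCells b n j) (hu : u ∈ allCells b n j) :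
    ∑ v ∈ allCells b n j, dirIncidence i w v * dirIncidence l u v
      + ∑ v ∈ allCells b n j, dirIncidence l v w * dirIncidence i v u = 0 := by
  have h1 := sum_dirIncidence_mul (allCells b n j) i w (R := ℤ) (fun v => dirIncidence l u v)
  have h2 := sum_dirIncidence_mul' (allCells b n j) l w (R := ℤ) (fun v => dirIncidence i v u)
  simp only [Int.cast_id] at h1 h2
  rw [h1, h2]
  simp only [dirIncidence_eq_coface i]
  unfold dirIncidence
  rw [← eq_neg_iff_add_eq_zero, ← Finset.sum_neg_distrib]
  simp only [Finset.mul_sum]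
  have e : ∀ (p : Prop) [Decidable p] (f : ℕ → ℤ),
      (if p then ∑ x ∈ Finset.range 2, f x else 0)
        = ∑ x ∈ Finset.range 2, if p then f x else 0 := by
    intro p _ f; split_ifs <;> simp
  simp only [e, ← Finset.sum_neg_distrib]
  conv_rhs => rw [Finset.sum_comm]
  refine Finset.sum_congr rfl fun ε _ => Finset.sum_congr rfl fun ε' _ => ?_
  simp only [mul_ite, mul_zero, ← ite_and]
  simp only [face_eq_face_iff hil hw hu]
  split_ifs with h
  · obtain ⟨⟨h1, h2⟩, h3, h4⟩ := h
    have hS : insert l w.2 = insert i u.2 := congrArg Prod.snd h4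
    have hlV : l ∈ insert l w.2 := by simp
    have hiV : i ∈ insert l w.2 := by simp [hS]
    have := orientSign_erase_mul hil hiV hlV
    rw [Finset.erase_insert h1] at this
    rw [hS, Finset.erase_insert h3] at this
    rw [hS]
    linear_combination (-1) ^ ε * (-1) ^ ε' * this
  · simp

end Combinatorics

/-! ### The cochain complex and its harmonic forms. -/

section Complex

variable {n : ℕ} {R : Type*} [CommRing R]

/-- Extension by zero of a form to all cells. -/
noncomputable def extend {b : BoundaryCondition} {j k : ℕ} (f : Form R b n j k)
    (w : LatticeCell n) : R :=
  if h : w ∈ cells b n j k then f ⟨w, h⟩ else 0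

theorem extend_coe {b : BoundaryCondition} {j k : ℕ} (f : Form R b n j k)
    (w : cells b n j k) : extend f w = f w := by
  simp [extend]

theorem extend_of_notMem {b : BoundaryCondition} {j k : ℕ} (f : Form R b n j k)
    {w : LatticeCell n} (h : w ∉ cells b n j k) : extend f w = 0 := by
  simp [extend, h]

theorem sum_cells_eq {b : BoundaryCondition} {j : ℕ} (k : ℕ) (F : LatticeCell n → R)
    (hF : ∀ v ∈ allCells b n j, v.2.card ≠ k → F v = 0) :
    ∑ v : cells b n j k, F v = ∑ v ∈ allCells b n j, F v := by
  rw [Finset.sum_coe_sort (cells b n j k) F]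
  refine Finset.sum_subset (fun v hv => (mem_cells_iff_mem_allCells.1 hv).1) fun v hv hv' => ?_
  refine hF v hv fun h => hv' (mem_cells_iff_mem_allCells.2 ⟨hv, h⟩)

theorem incidence_eq_zero_of_card {w v : LatticeCell n} (h : w.2.card ≠ v.2.card + 1) :
    incidence w v = 0 := by
  rw [← sum_dirIncidence]
  exact Finset.sum_eq_zero fun i _ => dirIncidence_eq_zero_of_card h

theorem d_mulVec_apply {b : BoundaryCondition} {j k : ℕ} (f : Form R b n j k)
    (w : cells b n j (k + 1)) :
    ((d R b n j k).mulVec f) w =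
      ∑ v ∈ allCells b n j, (incidence (w : LatticeCell n) v : R) * extend f v := by
  rw [← sum_cells_eq k]
  · simp [Matrix.mulVec, dotProduct, d, extend_coe]
  · intro v _ hv
    rw [extend_of_notMem f fun h => hv (mem_cells_iff.1 h).2, mul_zero]

theorem d_transpose_mulVec_apply {b : BoundaryCondition} {j k : ℕ} (f : Form R b n j (k + 1))
    (v : cells b n j k) :
    ((d R b n j k).transpose.mulVec f) v =
      ∑ w ∈ allCells b n j, (incidence w (v : LatticeCell n) : R) * extend f w := by
  rw [← sum_cells_eq (k + 1)]
  · simp [Matrix.mulVec, dotProduct, d, extend_coe]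
  · intro v _ hv
    rw [extend_of_notMem f fun h => hv (mem_cells_iff.1 h).2, mul_zero]

theorem sum_incidence_mul_extend_eq_zero {b : BoundaryCondition} {j k : ℕ} {f : Form R b n j k}
    (hf : (d R b n j k).mulVec f = 0) {w : LatticeCell n} (hw : w ∈ allCells b n j) :
    ∑ v ∈ allCells b n j, (incidence w v : R) * extend f v = 0 := by
  by_cases hk : w.2.card = k + 1
  · have := congrFun hf ⟨w, mem_cells_iff_mem_allCells.2 ⟨hw, hk⟩⟩
    rwa [d_mulVec_apply] at this
  · refine Finset.sum_eq_zero fun v hv => ?_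
    by_cases hv' : v.2.card = k
    · rw [incidence_eq_zero_of_card (by omega)]; simp
    · rw [extend_of_notMem f fun h => hv' (mem_cells_iff.1 h).2, mul_zero]

theorem sum_incidence_mul_extend_eq_zero' {b : BoundaryCondition} {j k : ℕ}
    {f : Form R b n j (k + 1)} (hf : (d R b n j k).transpose.mulVec f = 0) {v : LatticeCell n}
    (hv : v ∈ allCells b n j) :
    ∑ w ∈ allCells b n j, (incidence w v : R) * extend f w = 0 := by
  by_cases hk : v.2.card = k
  · have := congrFun hf ⟨v, mem_cells_iff_mem_allCells.2 ⟨hv, hk⟩⟩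
    rwa [d_transpose_mulVec_apply] at this
  · refine Finset.sum_eq_zero fun w hw => ?_
    by_cases hw' : w.2.card = k + 1
    · rw [incidence_eq_zero_of_card (by omega)]; simp
    · rw [extend_of_notMem f fun h => hw' (mem_cells_iff.1 h).2, mul_zero]

/-- Adding the double sum over directions to its transpose gives zero term by term, so twice the sum
is zero, in `ℤ`. -/
theorem sum_incidence_mul_incidence {b : BoundaryCondition} {j : ℕ} {w u : LatticeCell n}
    (hw : w ∈ allCells b n j) (hu : u ∈ allCells b n j) :
    ∑ v ∈ allCells b n j, incidence w v * incidence v u = 0 := by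
  have key : ∑ v ∈ allCells b n j, incidence w v * incidence v u
      = ∑ i, ∑ l, ∑ v ∈ allCells b n j, dirIncidence i w v * dirIncidence l v u := by
    simp only [← sum_dirIncidence, Finset.sum_mul_sum]
    rw [Finset.sum_comm]
    refine Finset.sum_congr rfl fun i _ => ?_
    rw [Finset.sum_comm]
  have key' := key
  rw [Finset.sum_comm] at key'
  have h2 := congrArg₂ (· + ·) key key'
  simp only [← Finset.sum_add_distrib] at h2
  rw [Finset.sum_eq_zero fun i _ => Finset.sum_eq_zero fun l _ => ?_] at h2
  · rw [Finset.sum_add_distrib] at h2; omega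
  · rw [Finset.sum_add_distrib]
    exact sum_dirIncidence_comp b j i l hw hu

theorem d_mul_d (R : Type*) [CommRing R] (b : BoundaryCondition) (n j k : ℕ) :
    d R b n j (k + 1) * d R b n j k = 0 := by
  ext w u
  have hw := (mem_cells_iff_mem_allCells.1 w.2).1
  have hu := mem_cells_iff_mem_allCells.1 u.2
  simp only [Matrix.mul_apply, d, Matrix.of_apply, Matrix.zero_apply]
  rw [sum_cells_eq (k + 1)
    (fun v => (incidence (w : LatticeCell n) v : R) * (incidence v (u : LatticeCell n) : R))]
  · exact_mod_cast congrArg (Int.cast : ℤ → R) (sum_incidence_mul_incidence hw hu.1)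
  · intro v _ hv
    rw [incidence_eq_zero_of_card (w := v) (by omega)]; simp

/-- Without cross terms the Laplacian is the sum of the one-directional Laplacians, so its quadratic
form at `F` is a sum of squares that vanishes. -/
theorem mulVec_eq_zero_of_sum_mulVec_eq_zero {ι T : Type*} [Fintype ι] [Fintype T]
    (D : ι → Matrix T T ℝ)
    (h : ∀ i l, i ≠ l → D i * (D l).transpose + (D l).transpose * D i = 0) {F : T → ℝ}
    (h1 : (∑ i, D i).mulVec F = 0) (h2 : (∑ i, D i).transpose.mulVec F = 0) (i : ι) :
    (D i).mulVec F = 0 ∧ (D i).transpose.mulVec F = 0 := by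
  classical
  have e : (∑ i, D i) * (∑ i, D i).transpose + (∑ i, D i).transpose * (∑ i, D i)
      = ∑ i, (D i * (D i).transpose + (D i).transpose * D i) := by
    rw [Matrix.transpose_sum, Finset.sum_mul_sum, Finset.sum_mul_sum,
      Finset.sum_comm (s := Finset.univ) (t := Finset.univ)
        (f := fun i l => (D i).transpose * D l), ← Finset.sum_add_distrib]
    refine Finset.sum_congr rfl fun i _ => ?_
    rw [← Finset.sum_add_distrib, Finset.sum_eq_single i]
    · intro l _ hl; exact h i l hl.symm
    · simp
  have e2 := congrArg (fun N => dotProduct F (N.mulVec F)) e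
  simp only [Matrix.add_mulVec, ← Matrix.mulVec_mulVec, h1, h2, Matrix.mulVec_zero, add_zero,
    dotProduct_zero, Matrix.sum_mulVec, dotProduct_sum, dotProduct_add] at e2
  have e3 : ∀ N : Matrix T T ℝ, dotProduct F (N.mulVec (N.transpose.mulVec F))
      = dotProduct (N.transpose.mulVec F) (N.transpose.mulVec F) := by
    intro N; rw [Matrix.dotProduct_mulVec, Matrix.mulVec_transpose]
  have e4 : ∀ N : Matrix T T ℝ, dotProduct F (N.transpose.mulVec (N.mulVec F))
      = dotProduct (N.mulVec F) (N.mulVec F) := by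
    intro N; simpa using e3 N.transpose
  have nn : ∀ x : T → ℝ, 0 ≤ dotProduct x x := fun x =>
    Finset.sum_nonneg fun t _ => mul_self_nonneg _
  simp only [e3, e4] at e2
  have := (Finset.sum_eq_zero_iff_of_nonneg (fun i _ => add_nonneg (nn _) (nn _))).1 e2.symm i
    (Finset.mem_univ i)
  have a := nn ((D i).transpose.mulVec F)
  have c := nn ((D i).mulVec F)
  exact ⟨dotProduct_self_eq_zero.1 (by linarith), dotProduct_self_eq_zero.1 (by linarith)⟩

theorem sum_dirIncidence_eq_zero {b : BoundaryCondition} {j : ℕ} {F : LatticeCell n → ℝ}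
    (h1 : ∀ w ∈ allCells b n j, ∑ v ∈ allCells b n j, (incidence w v : ℝ) * F v = 0)
    (h2 : ∀ v ∈ allCells b n j, ∑ w ∈ allCells b n j, (incidence w v : ℝ) * F w = 0) (i : Fin n) :
    (∀ w ∈ allCells b n j, ∑ v ∈ allCells b n j, (dirIncidence i w v : ℝ) * F v = 0) ∧
    (∀ v ∈ allCells b n j, ∑ w ∈ allCells b n j, (dirIncidence i w v : ℝ) * F w = 0) := by
  have key := mulVec_eq_zero_of_sum_mulVec_eq_zero (ι := Fin n) (T := allCells b n j)
    (fun i => Matrix.of fun w v => ((dirIncidence i w v : ℤ) : ℝ)) ?_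
    (F := fun w => F w) ?_ ?_ i
  · constructor
    · intro w hw
      refine Eq.trans ?_ (congrFun key.1 ⟨w, hw⟩)
      simp only [Matrix.mulVec, dotProduct, Matrix.of_apply]
      rw [Finset.sum_coe_sort (allCells b n j) (fun v => (dirIncidence i w v : ℝ) * F v)]
    · intro w hw
      refine Eq.trans ?_ (congrFun key.2 ⟨w, hw⟩)
      simp only [Matrix.mulVec, dotProduct, Matrix.of_apply, Matrix.transpose_apply]
      rw [Finset.sum_coe_sort (allCells b n j) (fun v => (dirIncidence i v w : ℝ) * F v)]
  · intro i l hil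
    ext w u
    simp only [Matrix.add_apply, Matrix.mul_apply, Matrix.of_apply, Matrix.transpose_apply,
      Matrix.zero_apply]
    rw [Finset.sum_coe_sort (allCells b n j)
        (fun v => (dirIncidence i w v : ℝ) * (dirIncidence l u v : ℝ)),
      Finset.sum_coe_sort (allCells b n j)
        (fun v => (dirIncidence l v w : ℝ) * (dirIncidence i v u : ℝ))]
    exact_mod_cast congrArg (Int.cast : ℤ → ℝ) (sum_dirIncidence_mixed b j hil w.2 u.2)
  · ext w
    rw [Pi.zero_apply, ← h1 w w.2]
    simp only [Matrix.mulVec, dotProduct, Matrix.sum_apply, Matrix.of_apply]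
    rw [← Finset.sum_coe_sort (allCells b n j)]
    refine Finset.sum_congr rfl fun v _ => ?_
    rw [← sum_dirIncidence]; simp
  · ext w
    rw [Pi.zero_apply, ← h2 w w.2]
    simp only [Matrix.mulVec, dotProduct, Matrix.sum_apply, Matrix.of_apply,
      Matrix.transpose_apply]
    rw [← Finset.sum_coe_sort (allCells b n j)]
    refine Finset.sum_congr rfl fun v _ => ?_
    rw [← sum_dirIncidence]; simp

/-- The equality holds also when a face lies outside `s`, where `F` is zero; this is how the
boundary condition enters. -/
theorem face_eq_of_sum_eq_zero {s : Finset (LatticeCell n)} {F : LatticeCell n → ℝ}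
    (hF : ∀ v, v ∉ s → F v = 0) {i : Fin n} {w : LatticeCell n} (hi : i ∈ w.2)
    (h : ∑ v ∈ s, (dirIncidence i w v : ℝ) * F v = 0) : F (face w i 1) = F (face w i 0) := by
  rw [sum_dirIncidence_mul] at h
  have e : ∀ ε, (if i ∈ w.2 ∧ face w i ε ∈ s then
      (((-1) ^ ε * orientSign w.2 i : ℤ) : ℝ) * F (face w i ε) else 0)
      = (((-1) ^ ε * orientSign w.2 i : ℤ) : ℝ) * F (face w i ε) := by
    intro ε
    split_ifs with h
    · rfl
    · rw [hF _ fun h' => h ⟨hi, h'⟩, mul_zero]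
  simp only [e, Finset.sum_range_succ, Finset.sum_range_zero, zero_add, pow_zero, pow_one,
    one_mul, neg_mul, Int.cast_neg] at h
  have h0 : (orientSign w.2 i : ℝ) ≠ 0 := by exact_mod_cast orientSign_ne_zero _ _
  have : (orientSign w.2 i : ℝ) * (F (face w i 0) - F (face w i 1)) = 0 := by linarith
  rcases mul_eq_zero.1 this with h' | h'
  · exact absurd h' h0
  · linarith

theorem coface_eq_of_sum_eq_zero {s : Finset (LatticeCell n)} {F : LatticeCell n → ℝ}
    (hF : ∀ v, v ∉ s → F v = 0) {i : Fin n} {v : LatticeCell n} (hi : i ∉ v.2)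
    (h : ∑ w ∈ s, (dirIncidence i w v : ℝ) * F w = 0) : F (coface v i 0) = F (coface v i 1) := by
  rw [sum_dirIncidence_mul'] at h
  have e : ∀ ε, (if i ∉ v.2 ∧ coface v i ε ∈ s then
      (((-1) ^ ε * orientSign (insert i v.2) i : ℤ) : ℝ) * F (coface v i ε) else 0)
      = (((-1) ^ ε * orientSign (insert i v.2) i : ℤ) : ℝ) * F (coface v i ε) := by
    intro ε
    split_ifs with h
    · rfl
    · rw [hF _ fun h' => h ⟨hi, h'⟩, mul_zero]
  simp only [e, Finset.sum_range_succ, Finset.sum_range_zero, zero_add, pow_zero, pow_one,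
    one_mul, neg_mul, Int.cast_neg] at h
  have h0 : (orientSign (insert i v.2) i : ℝ) ≠ 0 := by exact_mod_cast orientSign_ne_zero _ _
  have : (orientSign (insert i v.2) i : ℝ) * (F (coface v i 0) - F (coface v i 1)) = 0 := by
    linarith
  rcases mul_eq_zero.1 this with h' | h'
  · exact absurd h' h0
  · linarith

theorem mem_allCells_update {b : BoundaryCondition} {j : ℕ} {w : LatticeCell n}
    (hw : w ∈ allCells b n j) {i : Fin n} {y : ℤ} {S : Finset (Fin n)}
    (hS : ∀ m, m ≠ i → (m ∈ S ↔ m ∈ w.2)) (hy : y ∈ coordSet b j (i ∈ S)) :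
    ((Function.update w.1 i y, S) : LatticeCell n) ∈ allCells b n j := by
  rw [mem_allCells_iff] at *
  intro m
  by_cases hm : m = i
  · subst hm; simpa using hy
  · simpa [hm, hS m hm] using hw m

/-- With `0 < k < n` there are no harmonic `k`-forms. -/
theorem eq_zero_of_closed_of_coclosed {b : BoundaryCondition} {j k : ℕ} (hk : k + 1 < n)
    {f : Form ℝ b n j (k + 1)} (h1 : (d ℝ b n j (k + 1)).mulVec f = 0)
    (h2 : (d ℝ b n j k).transpose.mulVec f = 0) : f = 0 := by
  have hF : ∀ v, v ∉ allCells b n j → extend f v = 0 := fun v hv =>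
    extend_of_notMem f fun h => hv (mem_cells_iff_mem_allCells.1 h).1
  have key := sum_dirIncidence_eq_zero (F := extend f)
    (fun w hw => sum_incidence_mul_extend_eq_zero h1 hw)
    (fun w hw => sum_incidence_mul_extend_eq_zero' h2 hw)
  ext w
  rw [← extend_coe f w, Pi.zero_apply]
  obtain ⟨w, hw⟩ := w
  obtain ⟨hw, hcard⟩ := mem_cells_iff_mem_allCells.1 hw
  have hw' := mem_allCells_iff.1 hw
  dsimp only
  cases b
  -- Free case: coclosedness makes the form constant along a direction in which the cell extends.
  -- The induction starts at `-j - 1`, just outside the cube, where the extension is zero.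
  · obtain ⟨i, hi⟩ : w.2.Nonempty := Finset.card_pos.1 (by omega)
    have hwi := hw' i
    rw [coordSet, if_pos hi, Finset.mem_Ico] at hwi
    have ind : ∀ y : ℤ, -(j : ℤ) - 1 ≤ y → y ≤ j →
        extend f (Function.update w.1 i y, w.2) = 0 := by
      intro y hy
      induction y, hy using Int.leInduction with
      | base =>
        intro _
        refine hF _ fun h => ?_
        have := mem_allCells_iff.1 h i
        simp [coordSet, hi] at this
      | succ y hy ih =>
        intro hy'
        rw [← ih (by omega)]
        have hv : ((Function.update w.1 i (y + 1), w.2.erase i) : LatticeCell n)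
            ∈ allCells .free n j := by
          refine mem_allCells_update hw (fun m hm => by simp [hm]) ?_
          simp [coordSet]; omega
        have := coface_eq_of_sum_eq_zero hF (by simp) ((key i).2 _ hv)
        simpa [coface, hi] using this
    simpa using ind (w.1 i) (by omega) (by omega)
  -- Zero case: closedness makes the form constant along a direction orthogonal to the cell, and it
  -- vanishes on the wall `-j`. Such a direction exists because the degree is below `n`.
  · obtain ⟨i, hi⟩ : ∃ i, i ∉ w.2 := by
      by_contra! h
      rw [(Finset.eq_univ_iff_forall.2 h : w.2 = Finset.univ)] at hcard
      simp at hcard; omega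
    have hwi := hw' i
    rw [coordSet, if_neg hi, Finset.mem_Ioo] at hwi
    have ind : ∀ y : ℤ, -(j : ℤ) ≤ y → y ≤ j →
        extend f (Function.update w.1 i y, w.2) = 0 := by
      intro y hy
      induction y, hy using Int.leInduction with
      | base =>
        intro _
        refine hF _ fun h => ?_
        have := mem_allCells_iff.1 h i
        simp [coordSet, hi] at this
      | succ y hy ih =>
        intro hy'
        rw [← ih (by omega)]
        have hv : ((Function.update w.1 i y, insert i w.2) : LatticeCell n)
            ∈ allCells .zero n j := by
          refine mem_allCells_update hw (fun m hm => by simp [hm]) ?_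
          simp [coordSet]; omega
        have := face_eq_of_sum_eq_zero hF (by simp) ((key i).1 _ hv)
        simpa [face, hi] using this
    simpa using ind (w.1 i) (by omega) (by omega)

/-- A coclosed form of top degree is determined by its values on the cells of one layer. -/
theorem eq_zero_of_coclosed_of_layer {b : BoundaryCondition} {j k : ℕ} (i : Fin (k + 1))
    {f : Form ℝ b (k + 1) j (k + 1)}
    (h2 : (d ℝ b (k + 1) j k).transpose.mulVec f = 0)
    (h0 : ∀ w : cells b (k + 1) j (k + 1), w.1.1 i = -(j : ℤ) → f w = 0) : f = 0 := by
  have hF : ∀ v, v ∉ allCells b (k + 1) j → extend f v = 0 := fun v hv =>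
    extend_of_notMem f fun h => hv (mem_cells_iff_mem_allCells.1 h).1
  ext w
  rw [← extend_coe f w, Pi.zero_apply]
  obtain ⟨w, hwc⟩ := w
  obtain ⟨hw, hcard⟩ := mem_cells_iff_mem_allCells.1 hwc
  have hw' := mem_allCells_iff.1 hw
  have hu : w.2 = Finset.univ := by
    rw [← Finset.card_eq_iff_eq_univ, hcard, Fintype.card_fin]
  have hi : i ∈ w.2 := by simp [hu]
  have hwi := hw' i
  rw [coordSet.eq_def, if_pos hi, Finset.mem_Ico] at hwi
  have ind : ∀ y : ℤ, -(j : ℤ) ≤ y → y < j →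
      extend f (Function.update w.1 i y, w.2) = 0 := by
    intro y hy
    induction y, hy using Int.leInduction with
    | base =>
      intro hj
      have hm : ((Function.update w.1 i (-(j : ℤ)), w.2) : LatticeCell (k + 1))
          ∈ cells b (k + 1) j (k + 1) := by
        refine mem_cells_iff_mem_allCells.2 ⟨mem_allCells_update hw (fun m _ => Iff.rfl) ?_, hcard⟩
        simp [coordSet, hi]; omega
      rw [extend, dif_pos hm]
      exact h0 _ (by simp)
    | succ y hy ih =>
      intro hy'
      rw [← ih (by omega)]
      -- Since `-j < y + 1 < j`, this wall is interior and carries an equation under both boundary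
      -- conditions.
      have hv : ((Function.update w.1 i (y + 1), w.2.erase i) : LatticeCell (k + 1))
          ∈ allCells b (k + 1) j := by
        refine mem_allCells_update hw (fun m hm => by simp [hm]) ?_
        cases b <;> simp [coordSet] <;> omega
      have h3 := sum_incidence_mul_extend_eq_zero' h2 hv
      -- The wall lacks only the direction `i`, so it has cofaces in no other direction.
      have e : ∀ u, incidence u (Function.update w.1 i (y + 1), w.2.erase i)
          = dirIncidence i u (Function.update w.1 i (y + 1), w.2.erase i) := by
        intro u
        rw [← sum_dirIncidence]
        refine Finset.sum_eq_single i (fun l _ hl => ?_) (by simp)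
        rw [dirIncidence_eq_coface]
        simp [hu, hl]
      simp only [e] at h3
      have := coface_eq_of_sum_eq_zero hF (by simp) h3
      simpa [coface, hi] using this
  simpa using ind (w.1 i) (by omega) (by omega)

end Complex

/-! ### Numbers of cells and bounds on incidences. -/

section Counting

variable {n : ℕ}

theorem cells_filter_snd {b : BoundaryCondition} {j k : ℕ} {S : Finset (Fin n)}
    (hS : S.card = k) :
    (cells b n j k).filter (fun w => w.2 = S)
      = (Fintype.piFinset fun i => coordSet b j (i ∈ S)) ×ˢ {S} := by
  ext w
  simp only [Finset.mem_filter, mem_cells_iff, Finset.mem_product, Fintype.mem_piFinset,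
    Finset.mem_singleton]
  constructor
  · rintro ⟨⟨h1, -⟩, rfl⟩; exact ⟨h1, rfl⟩
  · rintro ⟨h1, rfl⟩; exact ⟨⟨h1, hS⟩, rfl⟩

theorem card_coordSet_true (b : BoundaryCondition) (j : ℕ) :
    (coordSet b j True).card = 2 * j := by
  cases b <;> simp [coordSet] <;> omega

theorem card_cells (b : BoundaryCondition) (n j k : ℕ) :
    (cells b n j k).card
      = n.choose k * ((2 * j) ^ k * (coordSet b j False).card ^ (n - k)) := by
  rw [Finset.card_eq_sum_card_fiberwise (f := Prod.snd)
    (t := (Finset.univ : Finset (Fin n)).powersetCard k)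
    (fun w hw => by simpa using (mem_cells_iff.1 hw).2)]
  rw [Finset.sum_congr rfl fun S hS => ?_, Finset.sum_const, Finset.card_powersetCard,
    Finset.card_univ, Fintype.card_fin, smul_eq_mul]
  have hS : S.card = k := by simpa using hS
  rw [cells_filter_snd hS, Finset.card_product, Finset.card_singleton, mul_one,
    Fintype.card_piFinset]
  have : ∀ i, (coordSet b j (i ∈ S)).card
      = if i ∈ S then 2 * j else (coordSet b j False).card := by
    intro i
    split_ifs with h
    · rw [← card_coordSet_true b j]; simp [h]
    · simp [h]
  simp only [this]
  rw [Finset.prod_ite, Finset.prod_const, Finset.prod_const]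
  congr 2
  · simp [hS]
  · rw [show Finset.univ.filter (fun i => i ∉ S) = Sᶜ by ext; simp, Finset.card_compl,
      Fintype.card_fin, hS]

theorem card_layer_le (b : BoundaryCondition) (j : ℕ) :
    ((cells b 4 j 4).filter (fun w => w.1 0 = -(j : ℤ))).card ≤ (2 * j) ^ 3 := by
  have : (cells b 4 j 4).filter (fun w => w.1 0 = -(j : ℤ)) ⊆
      (Fintype.piFinset fun i => if i = 0 then {-(j : ℤ)} else Finset.Ico (-(j : ℤ)) j)
        ×ˢ {Finset.univ} := by
    intro w hw
    rw [Finset.mem_filter, mem_cells_iff] at hw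
    obtain ⟨⟨h1, h2⟩, h3⟩ := hw
    have hu : w.2 = Finset.univ := by rw [← Finset.card_eq_iff_eq_univ, h2, Fintype.card_fin]
    simp only [Finset.mem_product, Fintype.mem_piFinset, Finset.mem_singleton, hu, and_true]
    intro i
    split_ifs with hi
    · simp [hi, h3]
    · simpa [coordSet.eq_def, hu] using h1 i
  refine (Finset.card_le_card this).trans ?_
  rw [Finset.card_product, Finset.card_singleton, mul_one, Fintype.card_piFinset,
    Fin.prod_univ_four]
  simp
  refine le_of_eq ?_
  have : ((j : ℤ) + j).toNat = 2 * j := by omega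
  rw [this]; ring

theorem abs_incidence_le (w v : LatticeCell n) : |incidence w v| ≤ 2 * n := by
  rw [← sum_dirIncidence]
  refine (Finset.abs_sum_le_sum_abs _ _).trans ?_
  refine (Finset.sum_le_card_nsmul _ _ 2 fun i _ => ?_).trans (by simp [mul_comm])
  unfold dirIncidence
  refine (Finset.abs_sum_le_sum_abs _ _).trans ?_
  refine (Finset.sum_le_card_nsmul _ _ 1 fun ε _ => ?_).trans (by simp)
  split_ifs
  · simp [orientSign]
  · simp

theorem exists_of_incidence_ne_zero {w v : LatticeCell n} (h : incidence w v ≠ 0) :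
    ∃ x : Fin n × ℕ, x.2 < 2 ∧ v = face w x.1 x.2 ∧ w = coface v x.1 x.2 := by
  rw [← sum_dirIncidence] at h
  obtain ⟨i, -, h⟩ := Finset.exists_ne_zero_of_sum_ne_zero h
  obtain ⟨ε, hε, h⟩ := Finset.exists_ne_zero_of_sum_ne_zero h
  have h : i ∈ w.2 ∧ v = face w i ε := by by_contra h'; simp [h'] at h
  exact ⟨(i, ε), by simpa using hε, h.2, (eq_face_iff.1 h).2⟩

theorem sum_sq_le_of_support_subset {α : Type*} [DecidableEq α] {s t : Finset α} {f : α → ℤ}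
    {K : ℤ} (hf : ∀ x, |f x| ≤ K) (ht : ∀ x, f x ≠ 0 → x ∈ t) :
    ∑ x ∈ s, f x ^ 2 ≤ t.card * K ^ 2 := by
  have hsub : ∑ x ∈ s, f x ^ 2 ≤ ∑ x ∈ t, f x ^ 2 := by
    rw [← Finset.sum_filter_ne_zero]
    refine Finset.sum_le_sum_of_subset_of_nonneg (fun x hx => ?_) fun x _ _ => sq_nonneg _
    exact ht x fun h => (Finset.mem_filter.1 hx).2 (by simp [h])
  refine hsub.trans ((Finset.sum_le_card_nsmul _ _ (K ^ 2) fun x _ => ?_).trans (by simp))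
  rw [← sq_abs]
  exact pow_le_pow_left₀ (abs_nonneg _) (hf x) 2

/-- A crude count: at most `2n` nonzero entries, each of size at most `2n`. Only uniformity in `j`
matters. -/
theorem sum_incidence_sq_le (s : Finset (LatticeCell n)) (w : LatticeCell n) :
    ∑ v ∈ s, incidence w v ^ 2 ≤ (2 * n) ^ 3 := by
  refine (sum_sq_le_of_support_subset (abs_incidence_le w)
    (t := (Finset.univ ×ˢ Finset.range 2).image fun x : Fin n × ℕ => face w x.1 x.2) ?_).trans ?_
  · intro v hv
    obtain ⟨x, h1, h2, -⟩ := exists_of_incidence_ne_zero hv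
    exact Finset.mem_image.2 ⟨x, by simpa using h1, h2.symm⟩
  · have := Finset.card_image_le (s := Finset.univ ×ˢ Finset.range 2)
      (f := fun x : Fin n × ℕ => face w x.1 x.2)
    rw [Finset.card_product, Finset.card_univ, Fintype.card_fin, Finset.card_range] at this
    have h : ((((Finset.univ ×ˢ Finset.range 2).image
      fun x : Fin n × ℕ => face w x.1 x.2).card : ℕ) : ℤ) ≤ n * 2 := by exact_mod_cast this
    nlinarith [sq_nonneg (2 * (n : ℤ))]

theorem sum_incidence_sq_le' (s : Finset (LatticeCell n)) (v : LatticeCell n) :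
    ∑ w ∈ s, incidence w v ^ 2 ≤ (2 * n) ^ 3 := by
  refine (sum_sq_le_of_support_subset (fun w => abs_incidence_le w v)
    (t := (Finset.univ ×ˢ Finset.range 2).image fun x : Fin n × ℕ => coface v x.1 x.2) ?_).trans ?_
  · intro w hw
    obtain ⟨x, h1, -, h2⟩ := exists_of_incidence_ne_zero hw
    exact Finset.mem_image.2 ⟨x, by simpa using h1, h2.symm⟩
  · have := Finset.card_image_le (s := Finset.univ ×ˢ Finset.range 2)
      (f := fun x : Fin n × ℕ => coface v x.1 x.2)
    rw [Finset.card_product, Finset.card_univ, Fintype.card_fin, Finset.card_range] at this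
    have h : ((((Finset.univ ×ˢ Finset.range 2).image
      fun x : Fin n × ℕ => coface v x.1 x.2).card : ℕ) : ℤ) ≤ n * 2 := by exact_mod_cast this
    nlinarith [sq_nonneg (2 * (n : ℤ))]

theorem incidence_coface_sq {v : LatticeCell n} {i : Fin n} (hi : i ∉ v.2) {ε : ℕ} (hε : ε < 2) :
    incidence (coface v i ε) v ^ 2 = 1 := by
  obtain ⟨h1, h2⟩ := eq_face_iff.2 ⟨hi, (rfl : coface v i ε = coface v i ε)⟩
  have : incidence (coface v i ε) v = dirIncidence i (coface v i ε) v := by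
    rw [← sum_dirIncidence]
    refine Finset.sum_eq_single i (fun l _ hl => ?_) (by simp)
    by_contra h
    have h3 := (card_of_dirIncidence_ne_zero h).1
    refine hi ?_
    rw [h3]
    simp [coface, Ne.symm hl]
  rw [this]
  conv_lhs => rw [show dirIncidence i (coface v i ε) v
    = dirIncidence i (coface v i ε) (face (coface v i ε) i ε) by rw [← h2]]
  rw [dirIncidence_face h1 hε, mul_pow, sq (orientSign _ _), orientSign_mul_self, ← pow_mul]
  simp

theorem exists_incidence_sq_eq_one {b : BoundaryCondition} {j k : ℕ} (hj : 1 ≤ j) (hk : k < n)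
    {v : LatticeCell n} (hv : v ∈ cells b n j k) :
    ∃ w ∈ cells b n j (k + 1), incidence w v ^ 2 = 1 := by
  obtain ⟨hv, hcard⟩ := mem_cells_iff_mem_allCells.1 hv
  obtain ⟨i, hi⟩ : ∃ i, i ∉ v.2 := by
    by_contra! h
    rw [(Finset.eq_univ_iff_forall.2 h : v.2 = Finset.univ)] at hcard
    simp at hcard; omega
  have hvi : -(j : ℤ) ≤ v.1 i ∧ v.1 i ≤ j := by
    have := mem_allCells_iff.1 hv i
    cases b
    · simpa [coordSet, hi] using this
    · simp [coordSet, hi] at this; omega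
  -- Extend upwards from `v`, except at the upper wall, where only the downward coface fits.
  obtain ⟨ε, hε, h⟩ : ∃ ε : ℕ, ε < 2 ∧ (-(j : ℤ) ≤ v.1 i - ε ∧ v.1 i - ε < j) := by
    by_cases h : v.1 i = j
    · exact ⟨1, by norm_num, by push_cast; omega⟩
    · exact ⟨0, by norm_num, by push_cast; omega⟩
  refine ⟨coface v i ε, mem_cells_iff_mem_allCells.2 ⟨?_, ?_⟩, incidence_coface_sq hi hε⟩
  · refine mem_allCells_update hv (fun m hm => by simp [hm]) ?_
    simpa [coordSet.eq_def] using h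
  · simp [coface, hi, hcard]

end Counting

/-! ### Hodge theory of a two-step complex `B * A = 0` over `ℝ`. -/

section Hodge

open Matrix

variable {I₂ I₃ I₄ : Type*} [Fintype I₂] [Fintype I₃] [Fintype I₄]
  {A : Matrix I₃ I₂ ℝ} {B : Matrix I₄ I₃ ℝ}

theorem mulVec_dotProduct_transpose {m n : Type*} [Fintype m] [Fintype n] (N : Matrix m n ℝ)
    (x : n → ℝ) (y : m → ℝ) : (N *ᵥ x) ⬝ᵥ y = x ⬝ᵥ (Nᵀ *ᵥ y) := by
  rw [dotProduct_comm, dotProduct_mulVec, mulVec_transpose, dotProduct_comm]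

theorem dotProduct_hodge_mulVec (A : Matrix I₃ I₂ ℝ) (B : Matrix I₄ I₃ ℝ) (x : I₃ → ℝ) :
    x ⬝ᵥ ((A * Aᵀ + Bᵀ * B) *ᵥ x) = (Aᵀ *ᵥ x) ⬝ᵥ (Aᵀ *ᵥ x) + (B *ᵥ x) ⬝ᵥ (B *ᵥ x) := by
  rw [add_mulVec, dotProduct_add, ← mulVec_mulVec, ← mulVec_mulVec,
    mulVec_dotProduct_transpose B, dotProduct_comm x (A *ᵥ _), mulVec_dotProduct_transpose A]

theorem isHermitian_hodge {I₃ : Type*} (A : Matrix I₃ I₂ ℝ) (B : Matrix I₄ I₃ ℝ) :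
    (A * Aᵀ + Bᵀ * B).IsHermitian := by
  rw [Matrix.IsHermitian, conjTranspose_eq_transpose_of_trivial, transpose_add, transpose_mul,
    transpose_mul, transpose_transpose, transpose_transpose]

theorem dotProduct_self_nonneg' {ι : Type*} [Fintype ι] (x : ι → ℝ) : 0 ≤ x ⬝ᵥ x :=
  Finset.sum_nonneg fun _ _ => mul_self_nonneg _

theorem posDef_hodge (h : ∀ x, Aᵀ *ᵥ x = 0 → B *ᵥ x = 0 → x = 0) :
    (A * Aᵀ + Bᵀ * B).PosDef := by
  refine PosDef.of_dotProduct_mulVec_pos (isHermitian_hodge A B) fun x hx => ?_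
  rw [star_trivial, dotProduct_hodge_mulVec]
  have h1 := dotProduct_self_nonneg' (Aᵀ *ᵥ x)
  have h2 := dotProduct_self_nonneg' (B *ᵥ x)
  refine lt_of_le_of_ne (add_nonneg h1 h2) fun h0 => hx (h x ?_ ?_)
  · exact dotProduct_self_eq_zero.1 (by linarith)
  · exact dotProduct_self_eq_zero.1 (by linarith)

theorem hodge_projection_apply [DecidableEq I₂] (M : Matrix I₃ I₃ ℝ) (p : I₂) :
    (Aᵀ * M * A) p p = (Aᵀ *ᵥ (M *ᵥ (A *ᵥ Pi.single p 1))) p := by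
  rw [mulVec_mulVec, mulVec_mulVec, mulVec_single_one]; simp [Matrix.mul_assoc]

variable [DecidableEq I₃]

theorem mulVec_inv_mulVec {M : Matrix I₃ I₃ ℝ} (hM : M.PosDef) (x : I₃ → ℝ) :
    M *ᵥ (M⁻¹ *ᵥ x) = x := by
  rw [mulVec_mulVec, mul_nonsing_inv _ ((isUnit_iff_isUnit_det _).1 hM.isUnit), one_mulVec]

/-- With `r` the potential of `q`, applying `B` to `A Aᵀ r + Bᵀ B r = q` gives `B Bᵀ B r = 0`.
Pairing with `B r` shows `Bᵀ B r = 0`, so only the exact part remains. -/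
theorem mulVec_transpose_mulVec_inv (hBA : B * A = 0) (hM : (A * Aᵀ + Bᵀ * B).PosDef)
    {q : I₃ → ℝ} (hq : B *ᵥ q = 0) : A *ᵥ (Aᵀ *ᵥ ((A * Aᵀ + Bᵀ * B)⁻¹ *ᵥ q)) = q := by
  set r := (A * Aᵀ + Bᵀ * B)⁻¹ *ᵥ q with hr
  have h := mulVec_inv_mulVec hM q
  rw [← hr, add_mulVec, ← mulVec_mulVec, ← mulVec_mulVec] at h
  have h1 := congrArg (fun x => (B *ᵥ r) ⬝ᵥ (B *ᵥ x)) h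
  simp only [mulVec_add, mulVec_mulVec _ B A, hBA, zero_mulVec, zero_add,
    hq, dotProduct_zero] at h1
  rw [dotProduct_comm, mulVec_dotProduct_transpose] at h1
  rw [dotProduct_self_eq_zero.1 h1, add_zero] at h
  exact h

theorem dotProduct_inv_mulVec_eq (hBA : B * A = 0) (hM : (A * Aᵀ + Bᵀ * B).PosDef)
    {q : I₃ → ℝ} (hq : B *ᵥ q = 0) :
    q ⬝ᵥ ((A * Aᵀ + Bᵀ * B)⁻¹ *ᵥ q) =
      (Aᵀ *ᵥ ((A * Aᵀ + Bᵀ * B)⁻¹ *ᵥ q)) ⬝ᵥ (Aᵀ *ᵥ ((A * Aᵀ + Bᵀ * B)⁻¹ *ᵥ q)) := by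
  conv_lhs => rw [← mulVec_transpose_mulVec_inv hBA hM hq]
  rw [mulVec_dotProduct_transpose, mulVec_transpose_mulVec_inv hBA hM hq]

theorem isIdempotentElem_hodge_projection [DecidableEq I₂] (hBA : B * A = 0)
    (hM : (A * Aᵀ + Bᵀ * B).PosDef) :
    IsIdempotentElem (Aᵀ * (A * Aᵀ + Bᵀ * B)⁻¹ * A) := by
  have : A * (Aᵀ * (A * Aᵀ + Bᵀ * B)⁻¹ * A) = A := by
    refine ext_of_mulVec_single fun p => ?_
    have := mulVec_transpose_mulVec_inv hBA hM (q := A *ᵥ Pi.single p 1)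
      (by rw [mulVec_mulVec, hBA, zero_mulVec])
    rw [← mulVec_mulVec, ← mulVec_mulVec, ← mulVec_mulVec, this]
  rw [IsIdempotentElem]
  conv_lhs => rw [Matrix.mul_assoc, this]

/-- An idempotent is a projection onto its range, so its trace is the dimension of that range. -/
theorem trace_eq_rank_of_isIdempotentElem [DecidableEq I₂] {P : Matrix I₂ I₂ ℝ}
    (hP : IsIdempotentElem P) : P.trace = P.rank := by
  have h : LinearMap.IsProj (LinearMap.range P.toLin') P.toLin' := by
    refine ⟨fun x => ⟨x, rfl⟩, ?_⟩
    rintro _ ⟨y, rfl⟩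
    rw [← LinearMap.comp_apply, ← Matrix.toLin'_mul, hP.eq]
  have := h.trace
  rw [Matrix.trace_toLin'_eq] at this
  rw [this, Matrix.rank]
  rfl

/-- The trace of the projection onto the range of `Aᵀ`. -/
theorem trace_hodge_projection_le [DecidableEq I₂] [DecidableEq I₄] (hBA : B * A = 0)
    (hM : (A * Aᵀ + Bᵀ * B).PosDef) (s : Finset I₄)
    (hs : ∀ f : I₄ → ℝ, Bᵀ *ᵥ f = 0 → (∀ w ∈ s, f w = 0) → f = 0) :
    (Aᵀ * (A * Aᵀ + Bᵀ * B)⁻¹ * A).trace + Fintype.card I₄ ≤ Fintype.card I₃ + s.card := by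
  rw [trace_eq_rank_of_isIdempotentElem (isIdempotentElem_hodge_projection hBA hM)]
  have h1 : (Aᵀ * (A * Aᵀ + Bᵀ * B)⁻¹ * A).rank ≤ A.rank := rank_mul_le_right _ _
  -- The range of `A` lies in the kernel of `B`; rank-nullity for `B`.
  have h2 : A.rank + B.rank ≤ Fintype.card I₃ := by
    have e := LinearMap.finrank_range_add_finrank_ker B.mulVecLin
    rw [Module.finrank_fintype_fun_eq_card] at e
    have : A.rank ≤ Module.finrank ℝ (LinearMap.ker B.mulVecLin) := by
      refine Submodule.finrank_mono ?_
      rintro _ ⟨x, rfl⟩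
      simp [hBA]
    have e' : B.rank = Module.finrank ℝ (LinearMap.range B.mulVecLin) := rfl
    omega
  -- By `hs`, restriction to `s` is injective on the kernel of `Bᵀ`; rank-nullity for `Bᵀ`.
  have h3 : Fintype.card I₄ ≤ B.rank + s.card := by
    have e := LinearMap.finrank_range_add_finrank_ker Bᵀ.mulVecLin
    rw [Module.finrank_fintype_fun_eq_card] at e
    have hr : Module.finrank ℝ (LinearMap.range Bᵀ.mulVecLin) = B.rank := by
      rw [← rank_transpose B]; rfl
    have : Module.finrank ℝ (LinearMap.ker Bᵀ.mulVecLin) ≤ s.card := by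
      let φ : LinearMap.ker Bᵀ.mulVecLin →ₗ[ℝ] (s → ℝ) :=
        (LinearMap.funLeft ℝ ℝ (Subtype.val : s → I₄)).comp (Submodule.subtype _)
      have hφ : Function.Injective φ := by
        rw [← LinearMap.ker_eq_bot, LinearMap.ker_eq_bot']
        rintro ⟨f, hf⟩ h
        have h' : ∀ w : s, f w = 0 := fun w => congrFun h w
        exact Subtype.ext (hs f (by rwa [LinearMap.mem_ker, mulVecLin_apply] at hf) fun w hw => h' ⟨w, hw⟩)
      simpa using LinearMap.finrank_le_finrank_of_injective hφ
    omega
  have : (Aᵀ * (A * Aᵀ + Bᵀ * B)⁻¹ * A).rank + Fintype.card I₄ ≤ Fintype.card I₃ + s.card := by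
    omega
  exact_mod_cast this

/-- Cauchy–Schwarz for the form `M`: its value at `t • u - M⁻¹ *ᵥ v` is a quadratic in `t` without
sign change, so the discriminant is nonpositive. -/
theorem sq_dotProduct_le_of_posDef {M : Matrix I₃ I₃ ℝ} (hM : M.PosDef) (u v : I₃ → ℝ) :
    (u ⬝ᵥ v) ^ 2 ≤ (v ⬝ᵥ (M⁻¹ *ᵥ v)) * (u ⬝ᵥ (M *ᵥ u)) := by
  have hsymm : M.transpose = M := by
    have := hM.isHermitian; rwa [Matrix.IsHermitian, conjTranspose_eq_transpose_of_trivial] at this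
  have key : ∀ t : ℝ, 0 ≤ (u ⬝ᵥ (M *ᵥ u)) * (t * t) + (-(2 * (u ⬝ᵥ v))) * t
      + v ⬝ᵥ (M⁻¹ *ᵥ v) := by
    intro t
    have := hM.posSemidef.dotProduct_mulVec_nonneg (t • u - M⁻¹ *ᵥ v)
    rw [star_trivial, mulVec_sub, mulVec_inv_mulVec hM, mulVec_smul, dotProduct_sub,
      sub_dotProduct, sub_dotProduct, smul_dotProduct, smul_dotProduct, dotProduct_smul,
      dotProduct_smul] at this
    have e1 : (M⁻¹ *ᵥ v) ⬝ᵥ (M *ᵥ u) = u ⬝ᵥ v := by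
      rw [dotProduct_comm, mulVec_dotProduct_transpose, hsymm, mulVec_inv_mulVec hM]
    rw [e1, dotProduct_comm (M⁻¹ *ᵥ v) v] at this
    simp only [smul_eq_mul] at this
    linarith
  have := discrim_le_zero key
  rw [discrim] at this
  nlinarith

/-- Lower bound on the diagonal entries of the projection. -/
theorem sq_apply_le_hodge_projection [DecidableEq I₂] {M : Matrix I₃ I₃ ℝ} (hM : M.PosDef)
    (p : I₂) (c : I₃) : A c p ^ 2 ≤ (Aᵀ * M⁻¹ * A) p p * M c c := by
  have := sq_dotProduct_le_of_posDef hM (Pi.single c 1) (A *ᵥ Pi.single p 1)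
  rw [hodge_projection_apply]
  have e : (A *ᵥ Pi.single p 1) ⬝ᵥ (M⁻¹ *ᵥ (A *ᵥ Pi.single p 1))
      = (Aᵀ *ᵥ (M⁻¹ *ᵥ (A *ᵥ Pi.single p 1))) p := by
    rw [mulVec_dotProduct_transpose, single_one_dotProduct]
  rw [e] at this
  simpa using this

end Hodge

/-! ### Gibbs sums over a countable configuration space: fluctuations, differentiation, integration.
-/

section Gibbs

variable {Q : Type*} {E φ : Q → ℝ}

/-- If shifting by `T` costs at least the energy `e + 2 φ`, the observable `φ` fluctuates: its
second moment is bounded below by a multiple of `exp (-a e)`. -/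
theorem exp_mul_tsum_le_tsum_sq {a e : ℝ} (ha : 0 ≤ a) (he : 0 ≤ e) (T : Q ≃ Q)
    (hE : ∀ q, E (T q) = E q + 2 * φ q + e) (hφ : ∀ q, φ (T q) = φ q + e)
    (hs : Summable fun q => Real.exp (-a * E q))
    (hs' : Summable fun q => φ q ^ 2 * Real.exp (-a * E q)) :
    e ^ 2 / 12 * Real.exp (-a * e) * ∑' q, Real.exp (-a * E q)
      ≤ ∑' q, φ q ^ 2 * Real.exp (-a * E q) := by
  set F : Q → ℝ := fun q => φ q ^ 2 * Real.exp (-a * E q) with hF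
  have hF0 : ∀ q, 0 ≤ F q := fun q => by positivity
  have hEs : ∀ q, E (T.symm q) = E q - 2 * φ q + e := fun q => by
    have h1 := hE (T.symm q)
    have h2 := hφ (T.symm q)
    rw [T.apply_symm_apply] at h1 h2
    linarith
  have hφs : ∀ q, φ (T.symm q) = φ q - e := fun q => by
    have h2 := hφ (T.symm q)
    rw [T.apply_symm_apply] at h2
    linarith
  -- If `|φ q| < e / 2`, shift in the direction given by the sign of `φ q`: then `|φ|` becomes at
  -- least `e / 2` and the energy rises by at most `e`. Summing the three translates turns `1/4`
  -- into `1/12`.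
  have pt : ∀ q, e ^ 2 / 4 * Real.exp (-a * e) * Real.exp (-a * E q)
      ≤ F q + F (T q) + F (T.symm q) := by
    intro q
    have key : ∀ q', e ^ 2 / 4 ≤ φ q' ^ 2 → E q' ≤ E q + e →
        e ^ 2 / 4 * Real.exp (-a * e) * Real.exp (-a * E q) ≤ F q' := by
      intro q' h1 h2
      rw [mul_assoc, ← Real.exp_add]
      refine mul_le_mul h1 (Real.exp_le_exp.2 ?_) (Real.exp_pos _).le (sq_nonneg _)
      nlinarith
    have h0 := hF0 q
    have h1 := hF0 (T q)
    have h2 := hF0 (T.symm q)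
    by_cases hb : e ^ 2 / 4 ≤ φ q ^ 2
    · linarith [key q hb (by linarith)]
    · have hlt : |φ q| < e / 2 := abs_lt_of_sq_lt_sq (by nlinarith) (by linarith)
      obtain ⟨hl, hr⟩ := abs_lt.1 hlt
      rcases le_total (φ q) 0 with h | h
      · linarith [key (T q) (by rw [hφ]; nlinarith) (by rw [hE]; linarith)]
      · linarith [key (T.symm q) (by rw [hφs]; nlinarith) (by rw [hEs]; linarith)]
  have sT : Summable fun q => F (T q) := (T.summable_iff (f := F)).2 hs'
  have sT' : Summable fun q => F (T.symm q) := (T.symm.summable_iff (f := F)).2 hs'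
  have h := (hs.mul_left (e ^ 2 / 4 * Real.exp (-a * e))).tsum_le_tsum pt ((hs'.add sT).add sT')
  rw [tsum_mul_left, (hs'.add sT).tsum_add sT', hs'.tsum_add sT, T.tsum_eq F,
    T.symm.tsum_eq F] at h
  linarith

theorem mul_exp_neg_le {a x : ℝ} (ha : 0 < a) :
    x * Real.exp (-a * x) ≤ 2 / a * Real.exp (-(a / 2) * x) := by
  have h1 : a / 2 * x ≤ Real.exp (a / 2 * x) := by linarith [Real.add_one_le_exp (a / 2 * x)]
  have h2 : Real.exp (-(a / 2) * x) = Real.exp (a / 2 * x) * Real.exp (-a * x) := by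
    rw [← Real.exp_add]; ring_nf
  rw [h2, ← mul_assoc]
  refine mul_le_mul_of_nonneg_right ?_ (Real.exp_pos _).le
  calc x = 2 / a * (a / 2 * x) := by field_simp
    _ ≤ _ := by gcongr

theorem summable_mul_exp_neg (hE : ∀ q, 0 ≤ E q)
    (hs : ∀ a : ℝ, 0 < a → Summable fun q => Real.exp (-a * E q)) {a : ℝ} (ha : 0 < a) :
    Summable fun q => E q * Real.exp (-a * E q) :=
  Summable.of_nonneg_of_le (fun q => mul_nonneg (hE q) (Real.exp_pos _).le)
    (fun q => mul_exp_neg_le ha) ((hs (a / 2) (by linarith)).mul_left (2 / a))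

/-- On `t > a / 2` the termwise derivatives are dominated by their size at `a / 2`, which is
summable because half of the exponent absorbs the factor `E q`. -/
theorem hasDerivAt_tsum_exp_neg (hE : ∀ q, 0 ≤ E q)
    (hs : ∀ a : ℝ, 0 < a → Summable fun q => Real.exp (-a * E q)) {a : ℝ} (ha : 0 < a) :
    HasDerivAt (fun t => ∑' q, Real.exp (-t * E q)) (-∑' q, E q * Real.exp (-a * E q)) a := by
  have h := hasDerivAt_tsum_of_isPreconnected (𝕜 := ℝ) (F := ℝ)
    (u := fun q => E q * Real.exp (-(a / 2) * E q))
    (g := fun q t => Real.exp (-t * E q)) (g' := fun q t => -(E q * Real.exp (-t * E q)))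
    (t := Set.Ioi (a / 2)) (y₀ := a) (y := a)
    (summable_mul_exp_neg hE hs (by linarith)) isOpen_Ioi isPreconnected_Ioi ?_ ?_
    (by simp; linarith) (hs a ha) (by simp; linarith)
  · rwa [tsum_neg] at h
  · intro q y _
    have h1 : HasDerivAt (fun t => Real.exp (-t * E q)) (Real.exp (-y * E q) * (-1 * E q)) y :=
      ((hasDerivAt_neg y).mul_const (E q)).exp
    exact h1.congr_deriv (by ring)
  · intro q y hy
    rw [norm_neg, Real.norm_of_nonneg (mul_nonneg (hE q) (Real.exp_pos _).le)]
    refine mul_le_mul_of_nonneg_left (Real.exp_le_exp.2 ?_) (hE q)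
    have : a / 2 < y := hy
    nlinarith [hE q]

theorem summable_exp_neg_mul_sq_int {c : ℝ} (hc : 0 < c) :
    Summable fun n : ℤ => Real.exp (-c * (n : ℝ) ^ 2) := by
  have hn : Summable fun n : ℕ => Real.exp (-c * (n : ℝ) ^ 2) := by
    refine Summable.of_nonneg_of_le (fun n => (Real.exp_pos _).le) (fun n => ?_)
      (Real.summable_exp_nat_mul_iff.2 (neg_lt_zero.2 hc))
    refine Real.exp_le_exp.2 ?_
    have : (n : ℝ) ≤ (n : ℝ) ^ 2 := by exact_mod_cast Nat.le_self_pow two_ne_zero n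
    nlinarith
  refine Summable.of_nat_of_neg ?_ ?_ <;> simpa using hn

theorem summable_prod_apply {ι α : Type*} [Fintype ι] {g : α → ℝ} (hg : ∀ x, 0 ≤ g x)
    (hs : Summable g) : Summable fun q : ι → α => ∏ i, g (q i) := by
  classical
  refine summable_of_sum_le (c := ∏ _i : ι, ∑' x, g x)
    (fun q => Finset.prod_nonneg fun i _ => hg _) fun u => ?_
  calc ∑ q ∈ u, ∏ i, g (q i)
      ≤ ∑ q ∈ Fintype.piFinset fun i => u.image fun q => q i, ∏ i, g (q i) := by
        refine Finset.sum_le_sum_of_subset_of_nonneg (fun q hq => ?_)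
          fun q _ _ => Finset.prod_nonneg fun i _ => hg _
        exact Fintype.mem_piFinset.2 fun i => Finset.mem_image_of_mem _ hq
    _ = ∏ i, ∑ x ∈ u.image fun q => q i, g x := (Finset.prod_univ_sum _ _).symm
    _ ≤ _ := Finset.prod_le_prod (fun i _ => Finset.sum_nonneg fun x _ => hg x)
        fun i _ => hs.sum_le_tsum _ fun x _ => hg x

theorem summable_exp_neg_sum_sq {ι : Type*} [Fintype ι] {c : ℝ} (hc : 0 < c) :
    Summable fun q : ι → ℤ => Real.exp (-c * ∑ i, (q i : ℝ) ^ 2) := by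
  have := summable_prod_apply (ι := ι) (fun n : ℤ => (Real.exp_pos (-c * (n : ℝ) ^ 2)).le)
    (summable_exp_neg_mul_sq_int hc)
  simpa only [← Real.exp_sum, ← Finset.mul_sum] using this

/-- The difference `g` of the two sides is antitone and is bounded below by a function tending to
zero, as `f` is nonnegative. No limit of `f` at infinity is needed. -/
theorem exp_neg_le_of_deriv_le {f f' : ℝ → ℝ} {β₀ c k : ℝ} (hk : 0 < k)
    (hf : ∀ t, β₀ ≤ t → HasDerivAt f (f' t) t) (hf0 : ∀ t, β₀ ≤ t → 0 ≤ f t)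
    (hf' : ∀ t, β₀ ≤ t → f' t ≤ -c * Real.exp (-k * t)) {β : ℝ} (hβ : β₀ ≤ β) :
    c * (Real.exp (-k * β) / k) ≤ f β := by
  set g : ℝ → ℝ := fun t => f t - c * (Real.exp (-k * t) / k) with hg
  have hd : ∀ t, β₀ ≤ t → HasDerivAt g (f' t + c * Real.exp (-k * t)) t := by
    intro t ht
    have h1 : HasDerivAt (fun t => c * (Real.exp (-k * t) / k))
        (c * (Real.exp (-k * t) * (-k * 1) / k)) t :=
      ((((hasDerivAt_id t).const_mul (-k)).exp).div_const k).const_mul c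
    exact ((hf t ht).sub h1).congr_deriv (by field_simp; ring)
  have hanti : AntitoneOn g (Set.Ici β₀) := by
    refine antitoneOn_of_deriv_nonpos (convex_Ici _)
      (fun t ht => (hd t ht).continuousAt.continuousWithinAt)
      (fun t ht => (hd t (interior_subset ht)).differentiableAt.differentiableWithinAt)
      fun t ht => ?_
    have ht := interior_subset ht
    rw [(hd t ht).deriv]
    linarith [hf' t ht]
  have hlim : Filter.Tendsto (fun t => -(c * (Real.exp (-k * t) / k))) Filter.atTop
      (nhds (-(c * (0 / k)))) := by
    refine (((Real.tendsto_exp_atBot.comp ?_).div_const k).const_mul c).neg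
    exact Filter.tendsto_id.const_mul_atTop_of_neg (neg_lt_zero.2 hk)
  have : -(c * (0 / k)) ≤ g β := by
    refine le_of_tendsto hlim (Filter.eventually_atTop.2 ⟨β, fun t ht => ?_⟩)
    have h1 := hanti (a := β) (b := t) hβ (hβ.trans ht) ht
    have h2 := hf0 t (hβ.trans ht)
    simp only [hg] at h1 ⊢
    linarith
  simp only [hg, zero_div, mul_zero, neg_zero] at this
  linarith

end Gibbs

/-! ### The Coulomb gas: energy, field, plaquette shifts. -/

section CoulombGas

open Matrix

/-- The exterior derivative from `2`-forms to `3`-forms. -/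
noncomputable abbrev dTwo (b : BoundaryCondition) (j : ℕ) :
    Matrix (cells b 4 j 3) (cells b 4 j 2) ℝ := d ℝ b 4 j 2

/-- The exterior derivative from `3`-forms to `4`-forms. -/
noncomputable abbrev dThree (b : BoundaryCondition) (j : ℕ) :
    Matrix (cells b 4 j 4) (cells b 4 j 3) ℝ := d ℝ b 4 j 3

/-- The positive Laplacian `-Δ` on `3`-forms. -/
noncomputable abbrev posLaplacian (b : BoundaryCondition) (j : ℕ) :
    Matrix (cells b 4 j 3) (cells b 4 j 3) ℝ :=
  dTwo b j * (dTwo b j)ᵀ + (dThree b j)ᵀ * dThree b j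

/-- The inclusion of integer forms into real forms. -/
def toRealForm {b : BoundaryCondition} {n j k : ℕ} (q : Form ℤ b n j k) : Form ℝ b n j k :=
  fun w => (q w : ℝ)

/-- The field `dᵗ (-Δ)⁻¹ q` generated by `q`. -/
noncomputable def coulombField (b : BoundaryCondition) (j : ℕ) (q : Form ℤ b 4 j 3) :
    Form ℝ b 4 j 2 :=
  (dTwo b j)ᵀ *ᵥ ((posLaplacian b j)⁻¹ *ᵥ toRealForm q)

/-- The self-energy of the charge `d 1_p`. -/
noncomputable def plaquetteEnergy (b : BoundaryCondition) (j : ℕ) (p : cells b 4 j 2) : ℝ :=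
  ((dTwo b j)ᵀ * (posLaplacian b j)⁻¹ * dTwo b j) p p

variable {b : BoundaryCondition} {j : ℕ}

theorem neg_laplacian : -(laplacian b 4 j 2) = posLaplacian b j := by
  simp only [laplacian, dStar, Matrix.mul_neg, Matrix.neg_mul, neg_add, neg_neg]

theorem dThree_mul_dTwo : dThree b j * dTwo b j = 0 := d_mul_d ℝ b 4 j 2

theorem posDef_posLaplacian : (posLaplacian b j).PosDef :=
  posDef_hodge fun _ h1 h2 => eq_zero_of_closed_of_coclosed (k := 2) (by norm_num) h2 h1

theorem toRealForm_d_mulVec {n k : ℕ} (q : Form ℤ b n j k) :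
    d ℝ b n j k *ᵥ toRealForm q = toRealForm ((d ℤ b n j k) *ᵥ q) := by
  ext w
  simp [toRealForm, mulVec, dotProduct, d]

theorem toRealForm_add {n k : ℕ} (q q' : Form ℤ b n j k) :
    toRealForm (q + q') = toRealForm q + toRealForm q' := by
  ext w; simp [toRealForm]

theorem toRealForm_single {n k : ℕ} (p : cells b n j k) :
    toRealForm (Pi.single p 1 : Form ℤ b n j k) = Pi.single p 1 := by
  ext w
  by_cases h : w = p
  · subst h; simp [toRealForm]
  · simp [toRealForm, h]

theorem dThree_mulVec_toRealForm (q : CoulombConfig b j) :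
    dThree b j *ᵥ toRealForm q.1 = 0 := by
  have := toRealForm_d_mulVec (n := 4) (k := 3) q.1
  rw [q.2] at this
  rw [this]; ext; simp [toRealForm]

theorem coulombEnergy_eq (q : Form ℤ b 4 j 3) :
    coulombEnergy b j q = toRealForm q ⬝ᵥ ((posLaplacian b j)⁻¹ *ᵥ toRealForm q) := by
  rw [coulombEnergy, neg_laplacian]; rfl

theorem coulombEnergy_eq_sum (q : CoulombConfig b j) :
    coulombEnergy b j q.1 = ∑ p, coulombField b j q.1 p ^ 2 := by
  rw [coulombEnergy_eq, dotProduct_inv_mulVec_eq dThree_mul_dTwo posDef_posLaplacian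
    (dThree_mulVec_toRealForm q)]
  simp [dotProduct, coulombField, sq]

theorem coulombEnergy_nonneg (q : CoulombConfig b j) : 0 ≤ coulombEnergy b j q.1 := by
  rw [coulombEnergy_eq_sum]; exact Finset.sum_nonneg fun _ _ => sq_nonneg _

/-- The charge `d 1_p`. -/
noncomputable def plaquetteCharge (p : cells b 4 j 2) : Form ℤ b 4 j 3 :=
  d ℤ b 4 j 2 *ᵥ Pi.single p 1

theorem toRealForm_plaquetteCharge (p : cells b 4 j 2) :
    toRealForm (plaquetteCharge p) = dTwo b j *ᵥ Pi.single p 1 := by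
  rw [plaquetteCharge, ← toRealForm_d_mulVec, toRealForm_single]

theorem d_mulVec_plaquetteCharge (p : cells b 4 j 2) :
    d ℤ b 4 j 3 *ᵥ plaquetteCharge p = 0 := by
  rw [plaquetteCharge, mulVec_mulVec, d_mul_d ℤ b 4 j 2, zero_mulVec]

/-- Adding the charge `d 1_p`. -/
noncomputable def plaquetteShift (p : cells b 4 j 2) : CoulombConfig b j ≃ CoulombConfig b j where
  toFun q := ⟨q.1 + plaquetteCharge p, by
    rw [mulVec_add, q.2, d_mulVec_plaquetteCharge, add_zero]⟩
  invFun q := ⟨q.1 - plaquetteCharge p, by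
    rw [mulVec_sub, q.2, d_mulVec_plaquetteCharge, sub_zero]⟩
  left_inv q := Subtype.ext (add_sub_cancel_right _ _)
  right_inv q := Subtype.ext (sub_add_cancel _ _)

theorem coulombField_plaquetteShift (p : cells b 4 j 2) (q : CoulombConfig b j) :
    coulombField b j (plaquetteShift p q).1 p = coulombField b j q.1 p + plaquetteEnergy b j p := by
  have : (plaquetteShift p q).1 = q.1 + plaquetteCharge p := rfl
  rw [this, coulombField, toRealForm_add, toRealForm_plaquetteCharge, mulVec_add, mulVec_add,
    Pi.add_apply, plaquetteEnergy, hodge_projection_apply]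
  rfl

theorem transpose_posLaplacian_inv : ((posLaplacian b j)⁻¹)ᵀ = (posLaplacian b j)⁻¹ := by
  have := (posDef_posLaplacian (b := b) (j := j)).inv.isHermitian
  rwa [Matrix.IsHermitian, conjTranspose_eq_transpose_of_trivial] at this

/-- The cross term is the field at `p`, by symmetry of `(-Δ)⁻¹` and by moving `d` to the other side.
-/
theorem coulombEnergy_plaquetteShift (p : cells b 4 j 2) (q : CoulombConfig b j) :
    coulombEnergy b j (plaquetteShift p q).1
      = coulombEnergy b j q.1 + 2 * coulombField b j q.1 p + plaquetteEnergy b j p := by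
  have : (plaquetteShift p q).1 = q.1 + plaquetteCharge p := rfl
  rw [this, coulombEnergy_eq, coulombEnergy_eq, toRealForm_add, toRealForm_plaquetteCharge]
  have e1 : ∀ x, (dTwo b j *ᵥ Pi.single p 1) ⬝ᵥ x = ((dTwo b j)ᵀ *ᵥ x) p := fun x => by
    rw [mulVec_dotProduct_transpose, single_one_dotProduct]
  have e2 : toRealForm q.1 ⬝ᵥ ((posLaplacian b j)⁻¹ *ᵥ (dTwo b j *ᵥ Pi.single p 1))
      = (dTwo b j *ᵥ Pi.single p 1) ⬝ᵥ ((posLaplacian b j)⁻¹ *ᵥ toRealForm q.1) := by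
    rw [dotProduct_comm, mulVec_dotProduct_transpose, transpose_posLaplacian_inv]
  rw [mulVec_add, dotProduct_add, add_dotProduct, add_dotProduct, e2, e1, e1, plaquetteEnergy,
    hodge_projection_apply, coulombField]
  ring

/-- Cauchy–Schwarz against each unit vector, summed, bounds the squared norm of `q` by the trace `t`
of `-Δ` times the energy; a product of Gaussian sums over `ℤ` then dominates. Using `t + 1` avoids
dividing by zero when there are no cells. -/
theorem summable_exp_neg_coulombEnergy {a : ℝ} (ha : 0 < a) :
    Summable fun q : CoulombConfig b j => Real.exp (-a * coulombEnergy b j q.1) := by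
  set t := ∑ c, posLaplacian b j c c with ht
  have ht0 : 0 ≤ t :=
    Finset.sum_nonneg fun c _ => (posDef_posLaplacian (b := b) (j := j)).posSemidef.diag_nonneg
  have h : ∀ q : CoulombConfig b j,
      1 / (t + 1) * ∑ c, (q.1 c : ℝ) ^ 2 ≤ coulombEnergy b j q.1 := by
    intro q
    have h1 : ∑ c, (q.1 c : ℝ) ^ 2 ≤ coulombEnergy b j q.1 * t := by
      rw [ht, Finset.mul_sum, coulombEnergy_eq]
      refine Finset.sum_le_sum fun c _ => ?_
      have := sq_dotProduct_le_of_posDef (posDef_posLaplacian (b := b) (j := j)) (Pi.single c 1)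
        (toRealForm q.1)
      simpa [toRealForm] using this
    have h2 := coulombEnergy_nonneg q
    rw [one_div, inv_mul_le_iff₀ (by linarith)]
    linarith
  have hs := (summable_exp_neg_sum_sq (ι := cells b 4 j 3) (c := a * (1 / (t + 1)))
    (by positivity)).comp_injective (i := fun q : CoulombConfig b j => q.1) Subtype.val_injective
  refine Summable.of_nonneg_of_le (fun q => (Real.exp_pos _).le) (fun q => ?_) hs
  refine Real.exp_le_exp.2 ?_
  have := mul_le_mul_of_nonneg_left (h q) ha.le
  linarith

/-- Test the projection against a single 3-cell having `p` as a face. The diagonal of `-Δ` is at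
most `2 * 8 ^ 3 = 1024`. -/
theorem plaquetteEnergy_ge (hj : 1 ≤ j) (p : cells b 4 j 2) :
    1 / 1024 ≤ plaquetteEnergy b j p := by
  obtain ⟨c, hc, hcp⟩ := exists_incidence_sq_eq_one hj (by norm_num) p.2
  have h := sq_apply_le_hodge_projection (posDef_posLaplacian (b := b) (j := j))
    (A := dTwo b j) p ⟨c, hc⟩
  have h1 : dTwo b j ⟨c, hc⟩ p ^ 2 = 1 := by
    simp only [dTwo, d, of_apply]
    exact_mod_cast hcp
  have h2 : posLaplacian b j ⟨c, hc⟩ ⟨c, hc⟩ ≤ 1024 := by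
    have e : posLaplacian b j ⟨c, hc⟩ ⟨c, hc⟩
        = ((∑ v ∈ cells b 4 j 2, incidence c v ^ 2 + ∑ w ∈ cells b 4 j 4, incidence w c ^ 2 : ℤ)
          : ℝ) := by
      rw [← Finset.sum_coe_sort (cells b 4 j 2), ← Finset.sum_coe_sort (cells b 4 j 4)]
      simp [posLaplacian, dTwo, dThree, d, Matrix.mul_apply, sq]
    rw [e]
    have h3 := sum_incidence_sq_le (cells b 4 j 2) c
    have h4 := sum_incidence_sq_le' (cells b 4 j 4) c
    norm_num at h3 h4
    exact_mod_cast (add_le_add h3 h4).trans (by norm_num)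
  rw [h1] at h
  change 1 ≤ plaquetteEnergy b j p * _ at h
  have h0 : 0 < posLaplacian b j ⟨c, hc⟩ ⟨c, hc⟩ := posDef_posLaplacian.diag_pos
  by_contra! hlt
  nlinarith

/-- The sum is the trace of the projection. Coclosed 4-forms are determined by one layer of
`4`-cells, whence the surface term. -/
theorem sum_plaquetteEnergy_le :
    ∑ p, plaquetteEnergy b j p + (cells b 4 j 4).card
      ≤ (cells b 4 j 3).card + (2 * (j : ℝ)) ^ 3 := by
  have h := trace_hodge_projection_le dThree_mul_dTwo (posDef_posLaplacian (b := b) (j := j))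
    (Finset.univ.filter fun w : cells b 4 j 4 => w.1.1 0 = -(j : ℤ)) ?_
  · rw [Fintype.card_coe, Fintype.card_coe] at h
    refine h.trans (add_le_add le_rfl ?_)
    have h1 : (Finset.univ.filter fun w : cells b 4 j 4 => w.1.1 0 = -(j : ℤ)).card
        ≤ ((cells b 4 j 4).filter fun w => w.1 0 = -(j : ℤ)).card := by
      refine Finset.card_le_card_of_injOn Subtype.val (fun w hw => ?_)
        Subtype.val_injective.injOn
      simp only [Finset.coe_filter, Finset.mem_univ, true_and, Set.mem_ofPred_eq] at hw ⊢
      exact ⟨w.2, hw⟩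
    exact_mod_cast h1.trans (card_layer_le b j)
  · intro f hf h0
    exact eq_zero_of_coclosed_of_layer (k := 3) 0 hf fun w hw => h0 w (by simpa using hw)

/-- Expand the energy as the sum of the squared field over plaquettes and apply the fluctuation
bound to each plaquette with its own shift. -/
theorem sum_plaquetteEnergy_mul_le {a : ℝ} (ha : 0 < a) (hj : 1 ≤ j) :
    (∑ p, plaquetteEnergy b j p ^ 2 / 12 * Real.exp (-a * plaquetteEnergy b j p))
        * ∑' q : CoulombConfig b j, Real.exp (-a * coulombEnergy b j q.1)
      ≤ ∑' q : CoulombConfig b j,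
        coulombEnergy b j q.1 * Real.exp (-a * coulombEnergy b j q.1) := by
  have hs := summable_mul_exp_neg (E := fun q : CoulombConfig b j => coulombEnergy b j q.1)
    coulombEnergy_nonneg (fun _ => summable_exp_neg_coulombEnergy) ha
  have hs' : ∀ p, Summable fun q : CoulombConfig b j =>
      coulombField b j q.1 p ^ 2 * Real.exp (-a * coulombEnergy b j q.1) := by
    intro p
    refine Summable.of_nonneg_of_le (fun q => by positivity) (fun q => ?_) hs
    refine mul_le_mul_of_nonneg_right ?_ (Real.exp_pos _).le
    rw [coulombEnergy_eq_sum]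
    exact Finset.single_le_sum (f := fun p => coulombField b j q.1 p ^ 2)
      (fun _ _ => sq_nonneg _) (Finset.mem_univ p)
  have e : ∀ q : CoulombConfig b j, coulombEnergy b j q.1 * Real.exp (-a * coulombEnergy b j q.1)
      = ∑ p, coulombField b j q.1 p ^ 2 * Real.exp (-a * coulombEnergy b j q.1) := fun q => by
    rw [← Finset.sum_mul, ← coulombEnergy_eq_sum]
  rw [tsum_congr e, Summable.tsum_finsetSum fun p _ => hs' p, Finset.sum_mul]
  refine Finset.sum_le_sum fun p _ => ?_
  exact exp_mul_tsum_le_tsum_sq ha.le (by linarith [plaquetteEnergy_ge hj p]) (plaquetteShift p)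
    (coulombEnergy_plaquetteShift p) (coulombField_plaquetteShift p)
    (summable_exp_neg_coulombEnergy ha) (hs' p)

theorem one_le_tsum_exp_neg_coulombEnergy {a : ℝ} (ha : 0 < a) :
    1 ≤ ∑' q : CoulombConfig b j, Real.exp (-a * coulombEnergy b j q.1) := by
  have h := (summable_exp_neg_coulombEnergy (b := b) (j := j) ha).le_tsum
    (⟨0, mulVec_zero _⟩ : CoulombConfig b j) fun _ _ => (Real.exp_pos _).le
  simpa [coulombEnergy, ← Pi.zero_def] using h

end CoulombGas

/-! ### Plaquettes of low self-energy and the derivative of the free energy. -/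

section FreeEnergy

variable {b : BoundaryCondition} {j : ℕ}

theorem card_coordSet_false_bounds (hj : 1 ≤ j) :
    2 * (j : ℝ) - 1 ≤ (coordSet b j False).card ∧
      ((coordSet b j False).card : ℝ) ≤ 2 * j + 1 := by
  cases b
  · have : (coordSet .free j False).card = 2 * j + 1 := by simp [coordSet]; omega
    rw [this]; push_cast; constructor <;> linarith
  · have : (coordSet .zero j False).card + 1 = 2 * j := by simp [coordSet]; omega
    have : ((coordSet .zero j False).card : ℝ) + 1 = 2 * j := by exact_mod_cast this
    constructor <;> linarith

/-- A positive fraction of the plaquettes has self-energy at most `(1 + δ) / 2`. -/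
theorem card_plaquetteEnergy_le {δ : ℝ} (hδ : 0 < δ) (hj : 1 ≤ j) (hjδ : 11 + 6 * δ ≤ 3 * δ * j) :
    3 * δ * (2 * (j : ℝ)) ^ 4
      ≤ (1 + δ) * (Finset.univ.filter fun p : cells b 4 j 2 =>
          plaquetteEnergy b j p ≤ (1 + δ) / 2).card := by
  set G := Finset.univ.filter fun p : cells b 4 j 2 => plaquetteEnergy b j p ≤ (1 + δ) / 2
    with hG
  have h1 : ((cells b 4 j 2).card : ℝ) * ((1 + δ) / 2)
      ≤ ∑ p, plaquetteEnergy b j p + G.card * ((1 + δ) / 2) := by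
    -- Markov's inequality, in pointwise form.
    have : ∀ p : cells b 4 j 2, (1 + δ) / 2 ≤ plaquetteEnergy b j p
        + if plaquetteEnergy b j p ≤ (1 + δ) / 2 then (1 + δ) / 2 else 0 := by
      intro p
      have := plaquetteEnergy_ge hj p
      split_ifs with h
      · linarith
      · linarith
    have h := Finset.sum_le_sum fun p (_ : p ∈ Finset.univ) => this p
    rw [Finset.sum_add_distrib, ← Finset.sum_filter, Finset.sum_const, Finset.sum_const,
      Finset.card_univ, Fintype.card_coe, nsmul_eq_mul, nsmul_eq_mul] at h
    exact h
  have h2 := sum_plaquetteEnergy_le (b := b) (j := j)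
  obtain ⟨hm1, hm2⟩ := card_coordSet_false_bounds (b := b) hj
  rw [card_cells] at h1
  rw [card_cells, card_cells] at h2
  rw [show Nat.choose 4 2 = 6 by rfl] at h1
  rw [show Nat.choose 4 3 = 4 by rfl] at h2
  push_cast at h1 h2
  set m : ℝ := ((coordSet b j False).card : ℝ)
  have hL : (2 : ℝ) ≤ 2 * j := by
    have : (1 : ℝ) ≤ j := by exact_mod_cast hj
    linarith
  -- With `L = 2j`, the counts give `(1 + δ)|G| ≥ 6δL⁴ - (22 + 12δ)L³`; this makes the surface error
  -- at most half of the main term.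
  have hjδ' : 22 + 12 * δ ≤ 3 * δ * (2 * j) := by linarith
  set L : ℝ := 2 * j
  norm_num at h1 h2
  have h3 : L ^ 2 - 2 * L ≤ m ^ 2 := by nlinarith
  have h4 : L ^ 2 * (L ^ 2 - 2 * L) ≤ L ^ 2 * m ^ 2 := by gcongr
  have h5 : L ^ 3 * m ≤ L ^ 3 * (L + 1) := by gcongr
  have h6 : L ^ 3 * (22 + 12 * δ) ≤ L ^ 3 * (3 * δ * L) := by gcongr
  have h7 := mul_le_mul_of_nonneg_left h4 (by linarith : 0 ≤ 6 * (1 + δ))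
  nlinarith

theorem coulombZ_eq (b : BoundaryCondition) (j : ℕ) (β : ℝ) :
    coulombZ b j β = ∑' q : CoulombConfig b j,
      Real.exp (-(β * ((2 * Real.pi) ^ 2 / 2)) * coulombEnergy b j q.1) := by
  simp only [coulombZ, coulombWeight, mul_div_assoc]

theorem summable_coulombWeight {β : ℝ} (hβ : 0 < β) : Summable (coulombWeight b j β) :=
  summable_exp_neg_coulombEnergy (by positivity)

theorem one_le_coulombZ {β : ℝ} (hβ : 0 < β) : 1 ≤ coulombZ b j β := by
  rw [coulombZ_eq]; exact one_le_tsum_exp_neg_coulombEnergy (by positivity)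

theorem coulombFreeEnergy_nonneg {β : ℝ} (hβ : 0 < β) : 0 ≤ coulombFreeEnergy b j β :=
  mul_nonneg (by positivity) (Real.log_nonneg (one_le_coulombZ hβ))

/-- The sum of the energies, weighted by the Boltzmann weights. -/
noncomputable def energySum (b : BoundaryCondition) (j : ℕ) (β : ℝ) : ℝ :=
  ∑' q : CoulombConfig b j, coulombEnergy b j q.1 *
    Real.exp (-(β * ((2 * Real.pi) ^ 2 / 2)) * coulombEnergy b j q.1)

theorem hasDerivAt_coulombFreeEnergy {β : ℝ} (hβ : 0 < β) :
    HasDerivAt (coulombFreeEnergy b j) (-(1 / (4 * (2 * (j : ℝ)) ^ 4) *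
      (energySum b j β * ((2 * Real.pi) ^ 2 / 2) / coulombZ b j β))) β := by
  have h1 := hasDerivAt_tsum_exp_neg (E := fun q : CoulombConfig b j => coulombEnergy b j q.1)
    coulombEnergy_nonneg (fun _ => summable_exp_neg_coulombEnergy)
    (a := β * ((2 * Real.pi) ^ 2 / 2)) (by positivity)
  have h2 : HasDerivAt (fun t : ℝ => t * ((2 * Real.pi) ^ 2 / 2))
      (1 * ((2 * Real.pi) ^ 2 / 2)) β := (hasDerivAt_id β).mul_const _
  have h3 : HasDerivAt (coulombZ b j)
      (-energySum b j β * (1 * ((2 * Real.pi) ^ 2 / 2))) β := by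
    have := h1.comp β h2
    rwa [show coulombZ b j = (fun t => ∑' q : CoulombConfig b j,
      Real.exp (-t * coulombEnergy b j q.1)) ∘ (fun t : ℝ => t * ((2 * Real.pi) ^ 2 / 2)) from
      funext fun t => coulombZ_eq b j t]
  have hZ := one_le_coulombZ (b := b) (j := j) hβ
  exact ((h3.log (by linarith)).const_mul (1 / (4 * (2 * (j : ℝ)) ^ 4))).congr_deriv (by ring)

theorem energySum_nonneg (b : BoundaryCondition) (j : ℕ) (β : ℝ) : 0 ≤ energySum b j β :=
  tsum_nonneg fun q => mul_nonneg (coulombEnergy_nonneg q) (Real.exp_pos _).le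

theorem deriv_coulombFreeEnergy_nonpos {β : ℝ} (hβ : 0 < β) :
    deriv (coulombFreeEnergy b j) β ≤ 0 := by
  rw [(hasDerivAt_coulombFreeEnergy hβ).deriv, neg_nonpos]
  have := one_le_coulombZ (b := b) (j := j) hβ
  have := energySum_nonneg b j β
  positivity

theorem deriv_coulombFreeEnergy_le {δ β : ℝ} (hδ : 0 < δ) (hβ : 0 < β) (hj : 1 ≤ j)
    (hjδ : 11 + 6 * δ ≤ 3 * δ * j) :
    deriv (coulombFreeEnergy b j) β
      ≤ -(Real.pi ^ 2 * δ / (2 ^ 23 * (1 + δ)) * Real.exp (-(Real.pi ^ 2 * β * (1 + δ)))) := by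
  rw [(hasDerivAt_coulombFreeEnergy hβ).deriv, neg_le_neg_iff]
  have hZ := one_le_coulombZ (b := b) (j := j) hβ
  set a := β * ((2 * Real.pi) ^ 2 / 2) with ha
  have ha0 : 0 < a := by positivity
  have h1 : (∑ p, plaquetteEnergy b j p ^ 2 / 12 * Real.exp (-a * plaquetteEnergy b j p))
      * coulombZ b j β ≤ energySum b j β := by
    rw [coulombZ_eq]; exact sum_plaquetteEnergy_mul_le ha0 hj
  have h2 := (le_div_iff₀ (by linarith : 0 < coulombZ b j β)).2 h1
  have h3 : (Finset.univ.filter fun p : cells b 4 j 2 =>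
        plaquetteEnergy b j p ≤ (1 + δ) / 2).card
        * ((1 / 1024) ^ 2 / 12 * Real.exp (-(Real.pi ^ 2 * β * (1 + δ))))
      ≤ ∑ p, plaquetteEnergy b j p ^ 2 / 12 * Real.exp (-a * plaquetteEnergy b j p) := by
    rw [← nsmul_eq_mul]
    refine (Finset.card_nsmul_le_sum _ _ _ fun p hp => ?_).trans
      (Finset.sum_le_sum_of_subset_of_nonneg (Finset.subset_univ _) fun p _ _ => by positivity)
    have hp : plaquetteEnergy b j p ≤ (1 + δ) / 2 := by simpa using hp
    have hp' := plaquetteEnergy_ge hj p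
    -- Here `a = 2π²β`, so a self-energy of `(1 + δ)/2` costs exactly `π²β(1 + δ)`.
    have hexp : Real.exp (-(Real.pi ^ 2 * β * (1 + δ)))
        ≤ Real.exp (-a * plaquetteEnergy b j p) := by
      refine Real.exp_le_exp.2 ?_
      have := mul_le_mul_of_nonneg_left hp ha0.le
      rw [ha] at this ⊢
      linarith
    gcongr
  have h4 := card_plaquetteEnergy_le (b := b) hδ hj hjδ
  set G : ℝ := ((Finset.univ.filter fun p : cells b 4 j 2 =>
        plaquetteEnergy b j p ≤ (1 + δ) / 2).card : ℝ)
  set X := Real.exp (-(Real.pi ^ 2 * β * (1 + δ)))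
  have hX : 0 < X := Real.exp_pos _
  have hL : 0 < 2 * (j : ℝ) := by
    have : (1 : ℝ) ≤ j := by exact_mod_cast hj
    linarith
  set L : ℝ := 2 * j
  have h5 : 3 * δ * L ^ 4 / (1 + δ) ≤ G := by rw [div_le_iff₀ (by linarith)]; linarith
  have h6 : 3 * δ * L ^ 4 / (1 + δ) * ((1 / 1024) ^ 2 / 12 * X)
      ≤ energySum b j β / coulombZ b j β :=
    (mul_le_mul_of_nonneg_right h5 (by positivity)).trans (h3.trans h2)
  have h7 := mul_le_mul_of_nonneg_left h6
    (by positivity : 0 ≤ 1 / (4 * L ^ 4) * ((2 * Real.pi) ^ 2 / 2))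
  calc _ = 1 / (4 * L ^ 4) * ((2 * Real.pi) ^ 2 / 2)
        * (3 * δ * L ^ 4 / (1 + δ) * ((1 / 1024) ^ 2 / 12 * X)) := by
        field_simp; norm_num
    _ ≤ _ := h7
    _ = _ := by ring

end FreeEnergy

end CubeForms

theorem propositionp (δ : ℝ) (hδ : 0 < δ) :
    ∃ β₀ : ℝ, 0 < β₀ ∧ ∃ C : ℝ, 0 < C ∧
      ∀ (b : CubeForms.BoundaryCondition) (β : ℝ), β₀ ≤ β → ∀ j : ℕ, 1 ≤ j →
        Summable (CubeForms.coulombWeight b j β) ∧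
        3 / 8 * (∫ t in Set.Ioi β, Real.exp (-(Real.pi ^ 2 * t * (1 + δ)))) - C / (j : ℝ)
          ≤ CubeForms.coulombFreeEnergy b j β ∧
        DifferentiableAt ℝ (CubeForms.coulombFreeEnergy b j) β ∧
        deriv (CubeForms.coulombFreeEnergy b j) β
          ≤ -(3 / 8) * Real.exp (-(β * Real.pi ^ 2 * (1 + δ))) * (1 - C / (j : ℝ)) := by
  have hpi : 1 ≤ Real.pi ^ 2 := by nlinarith [Real.pi_gt_three]
  -- The prefactor of `deriv_coulombFreeEnergy_le` at `δ / 2`, without its factor `π² ≥ 1`.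
  set K : ℝ := δ / 2 / (2 ^ 23 * (1 + δ / 2)) with hK
  have hK0 : 0 < K := by positivity
  -- For `j ≥ C` the size condition of `deriv_coulombFreeEnergy_le` holds at `δ / 2`.
  set C : ℝ := (11 + 3 * δ) / (3 * (δ / 2)) + 1 with hC
  have hC0 : 1 ≤ C := le_add_of_nonneg_left (by positivity)
  -- From this `β` on, `K * (β * (δ / 2)) ≥ 1/2 ≥ 3/8`, and the spare exponential dominates `β * (δ
  -- / 2)`.
  have hβ₀ : 0 < 1 / (K * δ) := by positivity
  set k : ℝ := Real.pi ^ 2 * (1 + δ) with hk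
  have hk1 : 1 ≤ k := by nlinarith
  have hint : ∀ β : ℝ, ∫ t in Set.Ioi β, Real.exp (-(Real.pi ^ 2 * t * (1 + δ)))
      = Real.exp (-k * β) / k := by
    intro β
    have := integral_exp_mul_Ioi (a := -k) (by linarith) β
    rw [neg_div_neg_eq] at this
    rw [← this]
    refine MeasureTheory.setIntegral_congr_fun measurableSet_Ioi fun t _ => ?_
    simp only [hk]
    ring_nf
  have hd : ∀ (b : CubeForms.BoundaryCondition) (β : ℝ), 1 / (K * δ) ≤ β → ∀ j : ℕ, 1 ≤ j →
      C ≤ j → deriv (CubeForms.coulombFreeEnergy b j) β ≤ -(3 / 8) * Real.exp (-k * β) := by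
    intro b β hβ j hj hCj
    have hβ0 : 0 < β := hβ₀.trans_le hβ
    have hjδ : 11 + 6 * (δ / 2) ≤ 3 * (δ / 2) * j := by
      have : (11 + 3 * δ) / (3 * (δ / 2)) ≤ j := by linarith
      rw [div_le_iff₀ (by positivity)] at this
      linarith
    refine (CubeForms.deriv_coulombFreeEnergy_le (b := b) (half_pos hδ) hβ0 hj hjδ).trans ?_
    have e : Real.exp (-(Real.pi ^ 2 * β * (1 + δ / 2)))
        = Real.exp (Real.pi ^ 2 * β * (δ / 2)) * Real.exp (-k * β) := by
      rw [← Real.exp_add, hk]; ring_nf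
    rw [e, neg_mul (3 / 8 : ℝ), neg_le_neg_iff, ← mul_assoc]
    refine mul_le_mul_of_nonneg_right ?_ (Real.exp_pos _).le
    have h1 : β * (δ / 2) ≤ Real.exp (Real.pi ^ 2 * β * (δ / 2)) := by
      refine le_trans ?_ (Real.add_one_le_exp _)
      nlinarith [mul_pos hβ0 hδ]
    have h2 : 1 ≤ β * (K * δ) := (div_le_iff₀ (by positivity)).1 hβ
    have h3 : K ≤ Real.pi ^ 2 * (δ / 2) / (2 ^ 23 * (1 + δ / 2)) := by
      rw [hK]; gcongr; nlinarith
    calc (3 / 8 : ℝ) ≤ K * (β * (δ / 2)) := by linarith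
      _ ≤ _ := mul_le_mul h3 h1 (by positivity) (by positivity)
  refine ⟨1 / (K * δ), hβ₀, C, by linarith, fun b β hβ j hj => ?_⟩
  have hβ0 : 0 < β := hβ₀.trans_le hβ
  have hj0 : (0 : ℝ) < j := by exact_mod_cast hj
  have hexp : Real.exp (-(β * Real.pi ^ 2 * (1 + δ))) = Real.exp (-k * β) := by
    rw [hk]; ring_nf
  have hCj0 : 0 < C / j := by positivity
  refine ⟨CubeForms.summable_coulombWeight hβ0, ?_,
    (CubeForms.hasDerivAt_coulombFreeEnergy hβ0).differentiableAt, ?_⟩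
  · rw [hint]
    rcases le_total C j with h | h
    · have := CubeForms.coulombFreeEnergy_nonneg (b := b) (j := j) hβ0
      have h1 := CubeForms.exp_neg_le_of_deriv_le (f := CubeForms.coulombFreeEnergy b j)
        (f' := deriv (CubeForms.coulombFreeEnergy b j)) (β₀ := 1 / (K * δ)) (c := 3 / 8) (k := k)
        (by linarith)
        (fun t ht => (CubeForms.hasDerivAt_coulombFreeEnergy
          (hβ₀.trans_le ht)).differentiableAt.hasDerivAt)
        (fun t ht => CubeForms.coulombFreeEnergy_nonneg (hβ₀.trans_le ht))
        (fun t ht => hd b t ht j hj h) hβ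
      linarith
    -- For `j ≤ C` the lower bound is nonpositive, since the integral is at most `1`.
    · have h1 : 1 ≤ C / j := (one_le_div hj0).2 h
      have h2 : Real.exp (-k * β) / k ≤ 1 := by
        rw [div_le_one (by linarith)]
        exact (Real.exp_le_one_iff.2 (by nlinarith)).trans hk1
      linarith [CubeForms.coulombFreeEnergy_nonneg (b := b) (j := j) hβ0]
  · rw [hexp]
    rcases le_total C j with h | h
    · refine (hd b β hβ j hj h).trans ?_
      nlinarith [mul_pos (Real.exp_pos (-k * β)) hCj0]
    · refine (CubeForms.deriv_coulombFreeEnergy_nonpos hβ0).trans ?_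
      have h1 : 1 ≤ C / j := (one_le_div hj0).2 h
      nlinarith [mul_nonneg (Real.exp_pos (-k * β)).le (sub_nonneg.2 h1)]
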